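/- Let $\mathcal H_A,\mathcal H_B$ be (possibly infinite dimensional) separable complex Hilbert spaces and let $\psi_1,\dots,\psi_M$ be orthonormal vectors in the Hilbert space tensor product $\mathcal H_A\otimes\mathcal H_B$. Fix an orthonormal basis $\{f_i\}$ of $\mathcal H_B$, write $\psi_l=\sum_i\varphi_i^l\otimes f_i$, and let $X_l:\mathcal H_B\to\mathcal H_A$ be the bounded operator $X_l\eta=\sum_i\langle f_i,\eta\rangle\varphi_i^l$, so that $\psi_l=\sum_i X_lf_i\otimes f_i$. Let $\mathcal K$ be the real linear span of the self-adjoint operators $X_m^*X_l+X_l^*X_m$ and $i(X_m^*X_l-X_l^*X_m)$, $m\ne l$, on $\mathcal H_B$, and suppose that $\dim_{\mathbb R}\mathcal K=3$. Then there is a conclusive LOCC protocol that distinguishes $\psi_1,\dots,\psi_M$ with success probability $$P_d\ \ge\ 1-\max_{1\le l\le M}\bigl(p_1^l+p_2^l\bigr).$$ Here $p_1^l\ge p_2^l\ge\cdots\ge 0$ are the Schmidt coefficients of $\psi_l$ in decreasing order (continued by zeros if there are finitely many), i.e. $\psi_l=\sum_{k:\,p^l_k\neq 0}\sqrt{p_k^l}\,a_k\otimes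 b_k$ with orthonormal families $(a_k)$ in $\mathcal H_A$ and $(b_k)$ in $\mathcal H_B$. An LOCC protocol consists of a bounded number of rounds; in each round one of the two parties performs a measurement on her or his own side, given by countably many Kraus operators $K_i$ with $\sum_iK_i^*K_i=1$ (strongly), and communicates the outcome to the other; who acts next, and the measurement performed, may depend on all previous outcomes. At the end the protocol announces either an index $m\in\{1,\dots,M\}$ or "inconclusive". It is conclusive if, for all $m\ne l$, it announces $m$ with probability $0$ when the state is $\psi_l$; its success probability is the minimum over $l$ of the probability that it announces $l$ when the state is $\psi_l$. -/

import Mathlib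

open scoped TensorProduct

set_option linter.unusedSectionVars false

namespace LocalDiscrimination

/-- The Hilbert space tensor product of two complex Hilbert spaces: the completion of the
algebraic tensor product for the inner product `⟪a ⊗ b, c ⊗ d⟫ = ⟪a, c⟫ * ⟪b, d⟫`. -/
abbrev HTensor (HA HB : Type*) [NormedAddCommGroup HA] [InnerProductSpace ℂ HA]
    [NormedAddCommGroup HB] [InnerProductSpace ℂ HB] : Type _ :=
  UniformSpace.Completion (HA ⊗[ℂ] HB)

section

variable {HA HB : Type*} [NormedAddCommGroup HA] [InnerProductSpace ℂ HA] [CompleteSpace HA]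
  [NormedAddCommGroup HB] [InnerProductSpace ℂ HB]

/-- The product vector `a ⊗ b` in the Hilbert space tensor product. -/
noncomputable def tmul (a : HA) (b : HB) : HTensor HA HB :=
  ((a ⊗ₜ[ℂ] b : HA ⊗[ℂ] HB) : HTensor HA HB)

/-- The operator `S ⊗ T` on the Hilbert space tensor product. -/
noncomputable def tensorOp (S : HA →L[ℂ] HA) (T : HB →L[ℂ] HB) :
    HTensor HA HB →L[ℂ] HTensor HA HB :=
  (TensorProduct.mapL S T).completion

/-- The component of a vector of `HA ⊗ HB` along `b`, a vector of `HA`: it is the operator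
`1 ⊗ ⟨b|`, which sends `a ⊗ b'` to `⟪b, b'⟫ • a`. If `{f i}` is an orthonormal basis of `HB`, then
`ψ = ∑ i, (slice (f i) ψ) ⊗ f i`. -/
noncomputable def slice (b : HB) : HTensor HA HB →L[ℂ] HA :=
  ((TensorProduct.ridIsometry ℂ HA : (HA ⊗[ℂ] ℂ) →L[ℂ] HA) ∘L
    (innerSL ℂ b).lTensor HA).fromCompletion

@[simp] lemma slice_tmul (b : HB) (a : HA) (b' : HB) :
    slice b (tmul a b') = inner ℂ b b' • a := by
  simp [slice, tmul]

lemma norm_slice_le (b : HB) (ψ : HTensor HA HB) : ‖slice b ψ‖ ≤ ‖b‖ * ‖ψ‖ := by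
  induction ψ using UniformSpace.Completion.induction_on with
  | hp => exact isClosed_le (by fun_prop) (by fun_prop)
  | ih x =>
    simp only [slice, ContinuousLinearMap.fromCompletion_apply_coe, UniformSpace.Completion.norm_coe]
    refine (ContinuousLinearMap.le_opNorm _ x).trans ?_
    gcongr
    refine (ContinuousLinearMap.opNorm_comp_le _ _).trans ?_
    have h1 := ContinuousLinearMap.norm_lTensor_le HA (innerSL ℂ b)
    have h2 := (TensorProduct.ridIsometry ℂ HA).toLinearIsometry.norm_toContinuousLinearMap_le
    rw [innerSL_apply_norm] at h1
    calc _ ≤ 1 * ‖b‖ := mul_le_mul h2 h1 (ContinuousLinearMap.opNorm_nonneg _) zero_le_one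
      _ = _ := one_mul _

lemma tensor_induction {P : HTensor HA HB → Prop} (hc : IsClosed {ψ | P ψ}) (h0 : P 0)
    (ht : ∀ a b, P (tmul a b)) (ha : ∀ x y, P x → P y → P (x + y)) (ψ : HTensor HA HB) : P ψ := by
  induction ψ using UniformSpace.Completion.induction_on with
  | hp => exact hc
  | ih x =>
    induction x using TensorProduct.induction_on with
    | zero => rw [UniformSpace.Completion.coe_zero]; exact h0
    | tmul a b => exact ht a b
    | add x y hx hy => rw [UniformSpace.Completion.coe_add]; exact ha _ _ hx hy

/-- `slice b ψ` as a conjugate linear map of `b`. -/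
noncomputable def sliceConj (ψ : HTensor HA HB) : HB →L⋆[ℂ] HA :=
  LinearMap.mkContinuous
    { toFun := fun b => slice b ψ
      map_add' := fun b c => by
        refine tensor_induction (P := fun ψ => slice (b + c) ψ = slice b ψ + slice c ψ)
          (isClosed_eq (by fun_prop) (by fun_prop)) (by simp) (fun a b' => ?_)
          (fun x y hx hy => ?_) ψ
        · simp [add_smul]
        · simp only [map_add, hx, hy]; abel
      map_smul' := fun r b => by
        refine tensor_induction (P := fun ψ => slice (r • b) ψ = (starRingEnd ℂ) r • slice b ψ)
          (isClosed_eq (by fun_prop) (by fun_prop)) (by simp) (fun a b' => ?_)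
          (fun x y hx hy => ?_) ψ
        · simp [mul_smul, smul_comm (inner ℂ b b')]
        · simp only [map_add, hx, hy, smul_add] }
    ‖ψ‖ (fun b => by simpa [mul_comm] using norm_slice_le b ψ)

@[simp] lemma sliceConj_apply (ψ : HTensor HA HB) (b : HB) : sliceConj ψ b = slice b ψ := rfl

variable {ι : Type*}

/-- Complex conjugation of `HB` with respect to an orthonormal basis. -/
noncomputable def conjWrt (f : HilbertBasis ι ℂ HB) (η : HB) : HB := f.repr.symm (star (f.repr η))

lemma hasSum_conjWrt (f : HilbertBasis ι ℂ HB) (η : HB) :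
    HasSum (fun i => (starRingEnd ℂ) (inner ℂ (f i) η) • f i) (conjWrt f η) := by
  simpa [conjWrt, f.repr_apply_apply] using f.hasSum_repr_symm (star (f.repr η))

lemma norm_conjWrt (f : HilbertBasis ι ℂ HB) (η : HB) : ‖conjWrt f η‖ = ‖η‖ := by
  simp [conjWrt]

lemma conjWrt_conjWrt (f : HilbertBasis ι ℂ HB) (η : HB) : conjWrt f (conjWrt f η) = η := by
  simp [conjWrt]

lemma inner_conjWrt (f : HilbertBasis ι ℂ HB) (x y : HB) :
    inner ℂ (conjWrt f x) (conjWrt f y) = inner ℂ y x := by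
  rw [conjWrt, conjWrt, LinearIsometryEquiv.inner_map_map, ← f.repr.inner_map_map y x,
    lp.inner_eq_tsum, lp.inner_eq_tsum]
  congr 1
  ext i
  simp [mul_comm]

lemma hasSum_slice (f : HilbertBasis ι ℂ HB) (ψ : HTensor HA HB) (η : HB) :
    HasSum (fun i => inner ℂ (f i) η • slice (f i) ψ) (slice (conjWrt f η) ψ) := by
  have h := (hasSum_conjWrt f η).mapL (sliceConj ψ)
  simpa using h

/-- The operator `X : HB → HA` that represents the vector `ψ = ∑ i, φ i ⊗ f i` of `HA ⊗ HB`, where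
`φ i = slice (f i) ψ`: it is given by `X η = ∑ i, ⟪f i, η⟫ • φ i` (a convergent sum). -/
noncomputable def toOperator (f : HilbertBasis ι ℂ HB) (ψ : HTensor HA HB) : HB →L[ℂ] HA :=
  LinearMap.mkContinuous
    { toFun := fun η => ∑' i, inner ℂ (f i) η • slice (f i) ψ
      map_add' := fun x y => by
        rw [← (hasSum_slice f ψ x).summable.tsum_add (hasSum_slice f ψ y).summable]
        simp [add_smul]
      map_smul' := fun r x => by
        rw [RingHom.id_apply, ← (hasSum_slice f ψ x).summable.tsum_const_smul r]
        simp [mul_smul] }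
    ‖ψ‖ (fun η => by
      have h := norm_slice_le (conjWrt f η) ψ
      rw [norm_conjWrt, mul_comm] at h
      simpa [(hasSum_slice f ψ η).tsum_eq] using h)

lemma toOperator_apply (f : HilbertBasis ι ℂ HB) (ψ : HTensor HA HB) (η : HB) :
    toOperator f ψ η = slice (conjWrt f η) ψ := (hasSum_slice f ψ η).tsum_eq

lemma toOperator_basis (f : HilbertBasis ι ℂ HB) (ψ : HTensor HA HB) (i : ι) :
    toOperator f ψ (f i) = slice (f i) ψ := by
  classical
  have : toOperator f ψ (f i) = ∑' j, inner ℂ (f j) (f i) • slice (f j) ψ := rfl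
  rw [this, tsum_eq_single i]
  · simp [f.orthonormal.1 i]
  · intro j hj
    simp [f.orthonormal.2 hj]


lemma toOperator_tmul (f : HilbertBasis ι ℂ HB) (a : HA) (b : HB) :
    toOperator f (tmul a b) =
      (ContinuousLinearMap.toSpanSingleton ℂ a) ∘L (innerSL ℂ (conjWrt f b)) := by
  ext η
  simp only [toOperator_apply, slice_tmul, ContinuousLinearMap.comp_apply, innerSL_apply_apply,
    ContinuousLinearMap.toSpanSingleton_apply]
  conv_lhs => rw [← conjWrt_conjWrt f b]
  rw [inner_conjWrt]

lemma toOperator_add (f : HilbertBasis ι ℂ HB) (x y : HTensor HA HB) :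
    toOperator f (x + y) = toOperator f x + toOperator f y := by
  ext η
  simp [toOperator_apply]

lemma continuous_toOperator (f : HilbertBasis ι ℂ HB) :
    Continuous (toOperator f : HTensor HA HB → (HB →L[ℂ] HA)) := by
  refine (LipschitzWith.of_dist_le_mul (K := 1) fun x y => ?_).continuous
  rw [dist_eq_norm, dist_eq_norm, NNReal.coe_one, one_mul]
  refine ContinuousLinearMap.opNorm_le_bound _ (norm_nonneg _) fun η => ?_
  have h := norm_slice_le (conjWrt f η) (x - y)
  rw [norm_conjWrt, mul_comm] at h
  simpa [toOperator_apply] using h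

lemma isCompactOperator_toOperator (f : HilbertBasis ι ℂ HB) (ψ : HTensor HA HB) :
    IsCompactOperator (toOperator f ψ) := by
  refine tensor_induction (P := fun ψ => IsCompactOperator (toOperator f ψ))
    (isClosed_setOfPred_isCompactOperator.preimage (continuous_toOperator f)) ?_ ?_ ?_ ψ
  · have : toOperator f (0 : HTensor HA HB) = 0 := by ext η; simp [toOperator_apply]
    rw [this]
    exact isCompactOperator_zero
  · intro a b
    rw [toOperator_tmul]
    exact (isCompactOperator_of_locallyCompactSpace_rng
      (ContinuousLinearMap.toSpanSingleton ℂ a)).comp_clm _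
  · intro x y hx hy
    rw [toOperator_add]
    exact hx.add hy

lemma norm_tmul (a : HA) (b : HB) : ‖tmul a b‖ = ‖a‖ * ‖b‖ := by
  simp [tmul]

/-- `tmul` as a continuous linear map in its first argument. -/
noncomputable def tmulL (b : HB) : HA →L[ℂ] HTensor HA HB :=
  UniformSpace.Completion.toComplL ∘L (TensorProduct.mkL ℂ HA HB).flip b

@[simp] lemma tmulL_apply (b : HB) (a : HA) : tmulL b a = tmul a b := rfl

lemma tmul_smul (r : ℂ) (a : HA) (b : HB) : tmul a (r • b) = r • tmul a b := by
  simp [tmul]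

lemma hasSum_tmul_right {κ : Type*} {v : κ → HB} {b : HB} (h : HasSum v b) (a : HA) :
    HasSum (fun k => tmul a (v k)) (tmul a b) :=
  h.mapL (UniformSpace.Completion.toComplL ∘L TensorProduct.mkL ℂ HA HB a)

/-- Decomposition of a vector of `HA ⊗ HB` along an orthonormal basis of `HB`. -/
lemma hasSum_tmul_slice {κ : Type*} (g : HilbertBasis κ ℂ HB) (ψ : HTensor HA HB) :
    HasSum (fun k => tmul (slice (g k) ψ) (g k)) ψ := by
  classical
  let V : Finset κ → HTensor HA HB →L[ℂ] HTensor HA HB :=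
    fun F => ∑ k ∈ F, tmulL (g k) ∘L slice (g k)
  let P : Finset κ → HB →L[ℂ] HB :=
    fun F => ∑ k ∈ F, (innerSL ℂ (g k)).smulRight (g k)
  have hP : ∀ F, ‖P F‖ ≤ 1 := by
    intro F
    refine ContinuousLinearMap.opNorm_le_bound _ zero_le_one fun x => ?_
    rw [one_mul]
    refine le_of_sq_le_sq ?_ (norm_nonneg x)
    have e : P F x = ∑ k ∈ F, inner ℂ (g k) x • g k := by simp [P]
    rw [e]
    have h1 : ‖∑ k ∈ F, inner ℂ (g k) x • g k‖ ^ 2 = ∑ k ∈ F, ‖inner ℂ (g k) x‖ ^ 2 := by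
      have := g.orthonormal.inner_sum (fun k => inner ℂ (g k) x) (fun k => inner ℂ (g k) x) F
      rw [inner_self_eq_norm_sq_to_K] at this
      have h3 : ∀ k, (starRingEnd ℂ) (inner ℂ (g k) x) * inner ℂ (g k) x
          = ((‖inner ℂ (g k) x‖ ^ 2 : ℝ) : ℂ) := by
        intro k
        rw [Complex.conj_mul']
        push_cast
        rfl
      simp only [h3] at this
      apply Complex.ofReal_injective
      rw [Complex.ofReal_sum]
      rw [← this]
      push_cast
      rfl
    rw [h1]
    exact g.orthonormal.sum_inner_products_le x
  have hVP : ∀ F, V F = ((P F).lTensor HA).completion := by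
    intro F
    ext ψ
    refine tensor_induction (P := fun ψ => V F ψ = ((P F).lTensor HA).completion ψ)
      (isClosed_eq (by fun_prop) (by fun_prop)) (by simp) ?_ ?_ ψ
    · intro a b
      have : ((P F).lTensor HA).completion (tmul a b) = tmul a (P F b) := by
        simp [tmul]
      rw [this]
      have e : P F b = ∑ k ∈ F, inner ℂ (g k) b • g k := by simp [P]
      have e2 : tmul a (∑ k ∈ F, inner ℂ (g k) b • g k)
          = ∑ k ∈ F, tmul a (inner ℂ (g k) b • g k) :=
        map_sum (UniformSpace.Completion.toComplL ∘L TensorProduct.mkL ℂ HA HB a) _ _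
      rw [e, e2]
      simp [V, tmul_smul]
    · intro x y hx hy
      simp only [map_add, hx, hy]
  have hV : ∀ F ψ, ‖V F ψ‖ ≤ ‖ψ‖ := by
    intro F ψ
    rw [hVP]
    induction ψ using UniformSpace.Completion.induction_on with
    | hp => exact isClosed_le (by fun_prop) (by fun_prop)
    | ih x =>
      rw [ContinuousLinearMap.completion_apply_coe, UniformSpace.Completion.norm_coe,
        UniformSpace.Completion.norm_coe]
      refine (ContinuousLinearMap.le_opNorm _ x).trans ?_
      have h1 := (ContinuousLinearMap.norm_lTensor_le HA (P F)).trans (hP F)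
      exact mul_le_of_le_one_left (norm_nonneg x) h1
  have heq : Equicontinuous (fun F ψ => V F ψ) := by
    refine Metric.equicontinuous_of_continuity_modulus (fun t => t) ?_ _ ?_
    · exact Filter.tendsto_id
    · intro x y F
      rw [dist_eq_norm, dist_eq_norm, ← map_sub]
      exact hV F _
  have main : Filter.Tendsto (fun F => V F ψ) Filter.atTop (nhds ψ) := by
    refine tensor_induction
      (P := fun ψ => Filter.Tendsto (fun F => V F ψ) Filter.atTop (nhds ψ))
      (heq.isClosed_setOfPred_tendsto continuous_id) (by simp) ?_ ?_ ψ
    · intro a b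
      have := hasSum_tmul_right (g.hasSum_repr b) a
      unfold HasSum at this
      simpa [V, g.repr_apply_apply, tmul_smul] using this
    · intro x y hx hy
      simpa only [map_add] using hx.add hy
  unfold HasSum
  simpa [V] using main

/-- The operator `X` represents `ψ`: `ψ = ∑ i, (X (f i)) ⊗ f i`. -/
lemma hasSum_toOperator (f : HilbertBasis ι ℂ HB) (ψ : HTensor HA HB) :
    HasSum (fun i => tmul (toOperator f ψ (f i)) (f i)) ψ := by
  simpa only [toOperator_basis] using hasSum_tmul_slice f ψ

/-- A positive function with finite superlevel sets can be listed in decreasing order. -/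
lemma exists_decreasing_list {S : Type*} (c : S → ℝ) (hpos : ∀ s, 0 < c s)
    (hfin : ∀ s, {t | c s ≤ c t}.Finite) :
    ∃ p : ℕ → ℝ, Antitone p ∧ (∀ n, 0 ≤ p n) ∧
      ∃ e : S ≃ {k // p k ≠ 0}, ∀ s, p (e s) = c s := by
  classical
  let _ : LinearOrder S := linearOrderOfSTO WellOrderingRel
  let key : S → ℝ ×ₗ S := fun s => toLex (-c s, s)
  have hkey : Function.Injective key := fun s t h => by
    have := congrArg (fun z => (ofLex z).2) h
    simpa [key] using this
  have hle : ∀ s t, key s ≤ key t → c t ≤ c s := by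
    intro s t h
    rw [Prod.Lex.le_iff] at h
    rcases h with h | h
    · simp only [key, ofLex_toLex] at h; linarith
    · simp only [key, ofLex_toLex] at h; linarith [h.1]
  have hf : ∀ s, {t | key t < key s}.Finite := fun s =>
    (hfin s).subset fun t ht => hle _ _ (le_of_lt ht)
  let rk : S → ℕ := fun s => {t | key t < key s}.ncard
  have hmono : ∀ s t, key s < key t → rk s < rk t := fun s t h =>
    Set.ncard_lt_ncard ⟨fun u hu => lt_trans hu h, fun hh => lt_irrefl (key s) (hh h)⟩ (hf t)
  have hinj : Function.Injective rk := fun s t h => by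
    rcases lt_trichotomy (key s) (key t) with h1 | h1 | h1
    · exact absurd h (hmono _ _ h1).ne
    · exact hkey h1
    · exact absurd h (hmono _ _ h1).ne'
  have hback : ∀ s t, rk s ≤ rk t → key s ≤ key t := fun s t h => by
    by_contra h1
    exact absurd (hmono _ _ (not_le.mp h1)) (not_lt.mpr h)
  have hlow : ∀ m, ∀ s, m < rk s → ∃ t, rk t = m := by
    intro m s hs
    by_contra hno
    push Not at hno
    have hex : ∃ n, ∃ t, rk t = n ∧ m < n := ⟨rk s, s, rfl, hs⟩
    obtain ⟨t, ht, hmt⟩ := Nat.find_spec hex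
    have hsub : rk '' {u | key u < key t} ⊆ (Finset.range m : Set ℕ) := by
      rintro _ ⟨u, hu, rfl⟩
      have h1 : rk u < Nat.find hex := ht ▸ hmono _ _ hu
      have h2 := Nat.find_min hex h1
      push Not at h2
      have h3 := h2 u rfl
      have h4 := hno u
      simp only [Finset.coe_range, Set.mem_Iio]
      omega
    have h1 := Set.ncard_le_ncard hsub (Finset.finite_toSet _)
    rw [Set.ncard_image_of_injective _ hinj, Set.ncard_coe_finset, Finset.card_range] at h1
    have : rk t ≤ m := h1
    omega
  let p : ℕ → ℝ := fun n => if h : ∃ s, rk s = n then c h.choose else 0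
  have hp : ∀ s, p (rk s) = c s := by
    intro s
    have h : ∃ t, rk t = rk s := ⟨s, rfl⟩
    simp only [p, dif_pos h]
    exact congrArg c (hinj h.choose_spec)
  have hp0 : ∀ n, (¬ ∃ s, rk s = n) → p n = 0 := fun n h => by simp only [p, dif_neg h]
  have hnn : ∀ n, 0 ≤ p n := by
    intro n
    by_cases h : ∃ s, rk s = n
    · obtain ⟨s, rfl⟩ := h
      rw [hp]; exact (hpos s).le
    · rw [hp0 n h]
  refine ⟨p, ?_, hnn, Equiv.ofBijective (fun s => ⟨rk s, by rw [hp]; exact (hpos s).ne'⟩)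
    ⟨fun s t h => hinj (congrArg Subtype.val h), ?_⟩, hp⟩
  · intro n m hnm
    by_cases h : ∃ s, rk s = m
    · obtain ⟨s, rfl⟩ := h
      have : ∃ t, rk t = n := by
        rcases hnm.lt_or_eq with h1 | h1
        · exact hlow n s h1
        · exact ⟨s, h1.symm⟩
      obtain ⟨t, rfl⟩ := this
      rw [hp, hp]
      exact hle _ _ (hback _ _ hnm)
    · rw [hp0 m h]; exact hnn n
  · rintro ⟨n, hn⟩
    by_contra h
    refine hn (hp0 n ?_)
    rintro ⟨s, rfl⟩
    exact h ⟨s, rfl⟩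

/-- `p 0 ≥ p 1 ≥ …` are the Schmidt coefficients of `ψ`, in decreasing order, repeated according to
multiplicity and continued by zeros if there are finitely many of them: `ψ` has a Schmidt
decomposition `ψ = ∑ k, √(p k) • a k ⊗ b k`, over the `k` with `p k ≠ 0`, with orthonormal families
`a` and `b`. So `p k` is the weight of the `k`-th term (`∑ k, p k = ‖ψ‖ ^ 2`), in other words the
eigenvalues of the reduced density operators, in decreasing order. -/
def IsSchmidtSequence (ψ : HTensor HA HB) (p : ℕ → ℝ) : Prop :=
  Antitone p ∧ (∀ k, 0 ≤ p k) ∧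
    ∃ (a : {k // p k ≠ 0} → HA) (b : {k // p k ≠ 0} → HB),
      Orthonormal ℂ a ∧ Orthonormal ℂ b ∧
        HasSum (fun k : {k // p k ≠ 0} => (Real.sqrt (p k) : ℂ) • tmul (a k) (b k)) ψ

variable [CompleteSpace HB]

/-- Every vector has a Schmidt decomposition. -/
lemma exists_isSchmidtSequence (ψ : HTensor HA HB) : ∃ p, IsSchmidtSequence ψ p := by
  classical
  obtain ⟨w, f, -⟩ := exists_hilbertBasis ℂ HB
  let X := toOperator f ψ
  let T : HB →L[ℂ] HB := ContinuousLinearMap.adjoint X ∘L X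
  have hTc : IsCompactOperator T := (isCompactOperator_toOperator f ψ).clm_comp (ContinuousLinearMap.adjoint X)
  have hTi : ∀ x y, inner ℂ x (T y) = inner ℂ (X x) (X y) := fun x y => by
    simp [T, ContinuousLinearMap.adjoint_inner_right]
  have hTs : (T : HB →ₗ[ℂ] HB).IsSymmetric := fun x y => by
    rw [← inner_conj_symm]
    change (starRingEnd ℂ) (inner ℂ y (T x)) = inner ℂ x (T y)
    rw [hTi, hTi, inner_conj_symm]
  have hbot := ContinuousLinearMap.orthogonalComplement_iSup_eigenspaces_eq_bot hTc hTs
  have hE : ∀ μ : ℂ, CompleteSpace (Module.End.eigenspace (T : Module.End ℂ HB) μ) := by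
    intro μ
    have : IsClosed (Module.End.eigenspace (T : Module.End ℂ HB) μ : Set HB) := by
      have e : (Module.End.eigenspace (T : Module.End ℂ HB) μ : Set HB)
          = {x | T x = μ • x} := by
        ext x; simp
      rw [e]
      exact isClosed_eq (by fun_prop) (by fun_prop)
    exact this.completeSpace_coe
  choose W B hB using fun μ : ℂ =>
    exists_hilbertBasis ℂ (Module.End.eigenspace (T : Module.End ℂ HB) μ)
  let v : (Σ μ : ℂ, W μ) → HB := fun s => (B s.1 s.2 : HB)
  have hv : Orthonormal ℂ v :=
    hTs.orthogonalFamily_eigenspaces.orthonormal_sigma_orthonormal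
      (fun μ => (B μ).orthonormal)
  have hvT : ∀ s, T (v s) = s.1 • v s := fun s =>
    Module.End.mem_eigenspace_iff.mp (B s.1 s.2).2
  have hvb : ∀ x, (∀ s, inner ℂ (v s) x = 0) → x = 0 := by
    intro x hx
    have : x ∈ (⨆ μ, Module.End.eigenspace (T : Module.End ℂ HB) μ)ᗮ := by
      rw [← Submodule.iInf_orthogonal, Submodule.mem_iInf]
      intro μ
      rw [Submodule.mem_orthogonal]
      intro u hu
      have h1 := ((B μ).hasSum_repr ⟨u, hu⟩).mapL
        (Module.End.eigenspace (T : Module.End ℂ HB) μ).subtypeL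
      have h2 := h1.mapL (innerSL ℂ x)
      have h3 : ∀ i, (innerSL ℂ x) ((Module.End.eigenspace (T : Module.End ℂ HB) μ).subtypeL
          ((B μ).repr ⟨u, hu⟩ i • (B μ) i)) = 0 := by
        intro i
        have h4 : inner ℂ x (v ⟨μ, i⟩) = 0 := by
          rw [← inner_conj_symm, hx, map_zero]
        have h5 : inner ℂ x ((B μ i : HB)) = 0 := h4
        simp [h5]
      simp only [h3] at h2
      have h6 : inner ℂ x u = 0 := h2.unique hasSum_zero
      rw [← inner_conj_symm, h6, map_zero]
    rw [hbot] at this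
    simpa using this
  let b : (Σ μ : ℂ, W μ) → HB := fun s => conjWrt f (v s)
  have hb : Orthonormal ℂ b := by
    rw [orthonormal_iff_ite] at hv ⊢
    intro s t
    simp only [b, inner_conjWrt, hv]
    simp [eq_comm]
  let g : HilbertBasis (Σ μ : ℂ, W μ) ℂ HB := HilbertBasis.mkOfOrthogonalEqBot hb (by
    rw [Submodule.eq_bot_iff]
    intro x hx
    have h1 : ∀ s, inner ℂ (v s) (conjWrt f x) = 0 := by
      intro s
      have h2 : inner ℂ (b s) x = 0 :=
        (Submodule.mem_orthogonal _ _).mp hx _ (Submodule.subset_span ⟨s, rfl⟩)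
      rw [← conjWrt_conjWrt f (v s), inner_conjWrt, ← inner_conj_symm]
      change (starRingEnd ℂ) (inner ℂ (b s) x) = 0
      rw [h2, map_zero]
    have h3 := hvb _ h1
    rw [← conjWrt_conjWrt f x, h3]
    simp [conjWrt])
  have hg : ∀ s, g s = b s := fun s => by simp [g]
  have hsum : HasSum (fun s => tmul (X (v s)) (b s)) ψ := by
    have := hasSum_tmul_slice g ψ
    simp only [hg] at this
    simpa only [X, toOperator_apply, b] using this
  have hXX : ∀ s t, inner ℂ (X (v s)) (X (v t)) = if s = t then t.1 else 0 := by
    intro s t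
    rw [← hTi, hvT, inner_smul_right, orthonormal_iff_ite.mp hv]
    simp
  have hre : ∀ s : Σ μ : ℂ, W μ, s.1 = ((‖X (v s)‖ ^ 2 : ℝ) : ℂ) := by
    intro s
    have h := hXX s s
    rw [if_pos rfl, inner_self_eq_norm_sq_to_K] at h
    rw [← h]; push_cast; rfl
  let S := {s : Σ μ : ℂ, W μ // X (v s) ≠ 0}
  let c : S → ℝ := fun s => ‖X (v s.1)‖ ^ 2
  have hcpos : ∀ s, 0 < c s := fun s => pow_pos (norm_pos_iff.mpr s.2) 2
  have hsumS : HasSum (fun s : S => tmul (X (v s.1)) (b s.1)) ψ := by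
    refine (hasSum_subtype_iff_of_support_subset
      (f := fun s => tmul (X (v s)) (b s)) (s := {s | X (v s) ≠ 0}) ?_).mpr hsum
    intro s hs
    by_contra h0
    refine hs ?_
    have h1 : X (v s) = 0 := not_not.mp h0
    simp [h1, tmul]
  have hfin : ∀ s, {t | c s ≤ c t}.Finite := by
    intro s
    have h1 := hsumS.summable.tendsto_cofinite_zero.norm
    rw [norm_zero] at h1
    have h2 := h1.eventually (gt_mem_nhds (norm_pos_iff.mpr s.2))
    refine Set.Finite.subset h2 ?_
    intro t ht
    have h3 : ‖X (v s.1)‖ ≤ ‖X (v t.1)‖ := le_of_sq_le_sq ht (norm_nonneg _)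
    simpa [norm_tmul, hb.1 t.1] using h3
  obtain ⟨p, hanti, hnn, e, he⟩ := exists_decreasing_list c hcpos hfin
  refine ⟨p, hanti, hnn, fun k => (‖X (v (e.symm k).1)‖⁻¹ : ℂ) • X (v (e.symm k).1),
    fun k => b (e.symm k).1, ?_, hb.comp _ (Subtype.val_injective.comp e.symm.injective), ?_⟩
  · have h1 : Orthonormal ℂ (fun s : S => (‖X (v s.1)‖⁻¹ : ℂ) • X (v s.1)) := by
      rw [orthonormal_iff_ite]
      intro s t
      rw [inner_smul_left, inner_smul_right, hXX]
      by_cases h : s = t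
      · subst h
        have hn : (‖X (v s.1)‖ : ℂ) ≠ 0 := by
          exact_mod_cast (norm_pos_iff.mpr s.2).ne'
        rw [if_pos rfl, if_pos rfl]
        conv_lhs => rw [hre s.1]
        rw [map_inv₀, Complex.conj_ofReal]
        push_cast
        field_simp
      · rw [if_neg h, if_neg (fun h' => h (Subtype.ext h'))]
        simp
    exact h1.comp _ e.symm.injective
  · rw [← e.hasSum_iff]
    convert hsumS using 1
    ext1 s
    have hn : (‖X (v s.1)‖ : ℂ) ≠ 0 := by
      exact_mod_cast (norm_pos_iff.mpr s.2).ne'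
    have h1 : Real.sqrt (p (e s)) = ‖X (v s.1)‖ := by
      rw [he, Real.sqrt_sq (norm_nonneg _)]
    simp only [Function.comp_apply, Equiv.symm_apply_apply, h1]
    rw [← tmulL_apply, ← tmulL_apply, map_smul, smul_smul, mul_inv_cancel₀ hn, one_smul]

/-- The `k`-th Schmidt coefficient of `ψ` in decreasing order, counted from `k = 0`. -/
noncomputable def schmidtCoeff (ψ : HTensor HA HB) : ℕ → ℝ :=
  (exists_isSchmidtSequence ψ).choose

lemma isSchmidtSequence_schmidtCoeff (ψ : HTensor HA HB) :
    IsSchmidtSequence ψ (schmidtCoeff ψ) := (exists_isSchmidtSequence ψ).choose_spec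

/-- The real linear span of the operators `X m† X l + X l† X m` and `i (X m† X l - X l† X m)`,
`m ≠ l`, on `HB`, where `X l` is the operator that represents `ψ l`. -/
noncomputable def associatedSpace (f : HilbertBasis ι ℂ HB) {M : ℕ} (ψ : Fin M → HTensor HA HB) :
    Submodule ℝ (HB →L[ℂ] HB) :=
  Submodule.span ℝ
    {A | ∃ m l : Fin M, m ≠ l ∧
      (A = ContinuousLinearMap.adjoint (toOperator f (ψ m)) ∘L toOperator f (ψ l) +
          ContinuousLinearMap.adjoint (toOperator f (ψ l)) ∘L toOperator f (ψ m) ∨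
        A = Complex.I •
          (ContinuousLinearMap.adjoint (toOperator f (ψ m)) ∘L toOperator f (ψ l) -
            ContinuousLinearMap.adjoint (toOperator f (ψ l)) ∘L toOperator f (ψ m)))}

end

/-- The operators `K 0, K 1, …` are the Kraus operators of a measurement with outcomes `0, 1, …`:
`∑ i, (K i)† K i = 1`, in the strong operator topology. A measurement with finitely many outcomes
is continued by zero operators. -/
def IsMeasurement {H : Type*} [NormedAddCommGroup H] [InnerProductSpace ℂ H] [CompleteSpace H]
    (K : ℕ → H →L[ℂ] H) : Prop :=
  ∀ x : H, HasSum (fun i => ContinuousLinearMap.adjoint (K i) (K i x)) x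

/-- LOCC protocols on `HA ⊗ HB` with at most `n` rounds and with final result in `Ω`. In each round
one of the two observers performs a measurement on her or his side and communicates the outcome `i`;
who acts next, and which measurement is performed, may depend on all outcomes so far. -/
inductive LOCC (HA HB : Type*) [NormedAddCommGroup HA] [InnerProductSpace ℂ HA] [CompleteSpace HA]
    [NormedAddCommGroup HB] [InnerProductSpace ℂ HB] [CompleteSpace HB] (Ω : Type) : ℕ → Type _
  | announce {n : ℕ} (o : Ω) : LOCC HA HB Ω n
  | alice {n : ℕ} (K : ℕ → HA →L[ℂ] HA) (hK : IsMeasurement K) (next : ℕ → LOCC HA HB Ω n) :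
      LOCC HA HB Ω (n + 1)
  | bob {n : ℕ} (K : ℕ → HB →L[ℂ] HB) (hK : IsMeasurement K) (next : ℕ → LOCC HA HB Ω n) :
      LOCC HA HB Ω (n + 1)

section

variable {HA HB : Type*} [NormedAddCommGroup HA] [InnerProductSpace ℂ HA] [CompleteSpace HA]
  [NormedAddCommGroup HB] [InnerProductSpace ℂ HB] [CompleteSpace HB]

open scoped Classical in
/-- The probability that the protocol announces `o` on the (unnormalized) state vector `φ`. The
unnormalized state after outcome `i` of a measurement by Alice is `(K i ⊗ 1) φ`, and the squared norm
of the unnormalized state is the probability of the outcomes so far. -/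
noncomputable def LOCC.prob {Ω : Type} (o : Ω) :
    {n : ℕ} → LOCC HA HB Ω n → HTensor HA HB → ENNReal
  | _, .announce o', φ => if o' = o then ENNReal.ofReal (‖φ‖ ^ 2) else 0
  | _, .alice K _ next, φ => ∑' i, (next i).prob o (tensorOp (K i) 1 φ)
  | _, .bob K _ next, φ => ∑' i, (next i).prob o (tensorOp 1 (K i) φ)

/-- A protocol whose result is `some m` (the conclusion that the state is `ψ m`) or `none` (no
conclusion) is conclusive for `ψ` if its conclusions are never wrong. -/
def LOCC.IsConclusive {M n : ℕ} (P : LOCC HA HB (Option (Fin M)) n)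
    (ψ : Fin M → HTensor HA HB) : Prop :=
  ∀ l m : Fin M, m ≠ l → P.prob (some m) (ψ l) = 0

/-- The probability that the protocol identifies the state, in the worst case over the states. -/
noncomputable def LOCC.successProb {M n : ℕ} (P : LOCC HA HB (Option (Fin M)) n)
    (ψ : Fin M → HTensor HA HB) : ENNReal :=
  ⨅ l : Fin M, P.prob (some l) (ψ l)

end

end LocalDiscrimination

/-! Bob measures in an orthonormal basis chosen so that, for all outcomes except at most two, the
states left to Alice are mutually orthogonal. She then identifies the state without error, and the
exceptional outcomes are declared inconclusive.

If Bob finds the conjugate of `v`, Alice's state for `ψ l` is `X l v`. These states are orthogonal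
exactly when the forms of all operators of the associated space vanish at `v`. The task is therefore
to find a basis in which three independent self-adjoint operators have zero diagonal up to two
entries. Orthogonality of the `ψ l` makes all diagonal sums zero (`hasSum_inner_associatedSpace`).

Take a maximal orthonormal set `S` of common zeros of the forms
(`exists_hilbertBasis_diagonal_zero`). If its orthogonal complement had dimension at least three,
the joint numerical range there would be convex (`convex_jointNumericalRange`). If this range missed
`0`, a supporting functional would give an operator of the space whose form is nonnegative and not
identically zero on the complement, and zero on `S`. This contradicts trace zero. If the range
contained `0`, `S` could be enlarged. So at most two basis vectors are left over.

The probability lost on two orthonormal vectors of Bob is bounded by Ky Fan's principle: it is at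
most the sum of the two largest Schmidt coefficients (`sum_norm_sq_slice_le`).

Convexity rests on a continuity argument, `exists_common_zero_of_sign_change`. Two of the real forms
are merged into one complex equation, which is followed along a path of affine lines until the third
form vanishes. -/

namespace LocalDiscrimination

/-! ### Common zeros of three Hermitian forms. -/

section JointNumericalRange

variable {H : Type*} [NormedAddCommGroup H] [InnerProductSpace ℂ H] [CompleteSpace H]

/-- The real linear equation `conj k * a + k * b = 0` has a nontrivial solution if `|a| = |b|`. -/
lemma exists_conj_mul_add_mul_eq_zero {a b : ℂ} (h : Complex.normSq a = Complex.normSq b) :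
    ∃ k : ℂ, k ≠ 0 ∧ (starRingEnd ℂ) k * a + k * b = 0 := by
  have ha : (starRingEnd ℂ) a * a = Complex.normSq a := Complex.normSq_eq_conj_mul_self.symm
  have hb : (starRingEnd ℂ) b * b = Complex.normSq b := Complex.normSq_eq_conj_mul_self.symm
  by_cases h1 : a = (starRingEnd ℂ) b
  · by_cases h2 : b = 0
    · exact ⟨1, one_ne_zero, by simp [h1, h2]⟩
    -- Here the equation only says that `k * b` has real part zero.
    · refine ⟨Complex.I * (starRingEnd ℂ) b, by simpa using h2, ?_⟩
      rw [h1]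
      simp only [map_mul, Complex.conj_I, Complex.conj_conj]
      ring
  -- With this `k` the left side is `|a|² - |b|²`.
  · refine ⟨a - (starRingEnd ℂ) b, sub_ne_zero.mpr h1, ?_⟩
    simp only [map_sub, Complex.conj_conj]
    have h3 : (Complex.normSq a : ℂ) = Complex.normSq b := by rw [h]
    linear_combination ha - hb + h3

lemma inner_add_smul_map (B : H →L[ℂ] H) (w e : H) (x : ℂ) :
    inner ℂ (w + x • e) (B (w + x • e)) = inner ℂ w (B w) +
      ((starRingEnd ℂ) x * inner ℂ e (B w) + x * inner ℂ w (B e)) +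
      Complex.normSq x * inner ℂ e (B e) := by
  simp only [map_add, map_smul, inner_add_left, inner_add_right, inner_smul_left, inner_smul_right,
    Complex.normSq_eq_conj_mul_self]
  ring

lemma re_inner_add_smul_map {A : H →L[ℂ] H} (hA : IsSelfAdjoint A) (w e : H) (x : ℂ) :
    (inner ℂ (w + x • e) (A (w + x • e))).re = (inner ℂ w (A w)).re +
      2 * ((starRingEnd ℂ) x * inner ℂ e (A w)).re +
      Complex.normSq x * (inner ℂ e (A e)).re := by
  rw [inner_add_smul_map]
  have h : x * inner ℂ w (A e) = (starRingEnd ℂ) ((starRingEnd ℂ) x * inner ℂ e (A w)) := by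
    rw [map_mul, Complex.conj_conj, inner_conj_symm,
      ← ContinuousLinearMap.adjoint_inner_right, hA.adjoint_eq]
  rw [h]
  simp only [Complex.add_re, Complex.conj_re, Complex.re_ofReal_mul]
  ring

/-- If `v ↦ ⟪v, B v⟫` vanishes on a point of the affine line `w + ℂ e` at which the form of `A` is
not positive, and is degenerate along this line, then it has a common zero with the form of `A`. -/
lemma exists_common_zero_of_degenerate {B A : H →L[ℂ] H} (hA : IsSelfAdjoint A) {w e : H} {x : ℂ}
    (he : inner ℂ e (B e) = 0) (heA : 0 < (inner ℂ e (A e)).re)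
    (hB : inner ℂ (w + x • e) (B (w + x • e)) = 0)
    (hx : (inner ℂ (w + x • e) (A (w + x • e))).re ≤ 0)
    (hd : Complex.normSq (inner ℂ e (B w)) = Complex.normSq (inner ℂ w (B e))) :
    ∃ y : ℂ, inner ℂ (w + y • e) (B (w + y • e)) = 0 ∧
      (inner ℂ (w + y • e) (A (w + y • e))).re = 0 := by
  obtain ⟨k, hk0, hk⟩ := exists_conj_mul_add_mul_eq_zero hd
  set a := (inner ℂ (w + x • e) (A (w + x • e))).re with ha
  set b := 2 * ((starRingEnd ℂ) k * inner ℂ e (A (w + x • e))).re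
  set c := Complex.normSq k * (inner ℂ e (A e)).re
  have hc : 0 < c := mul_pos (Complex.normSq_pos.mpr hk0) heA
  -- The real line `x + τ k` consists of zeros of the form of `B`. On it the form of `A` is a
  -- quadratic polynomial with `a ≤ 0 < c`, hence with nonnegative discriminant.
  have hq : ∀ τ : ℝ, (inner ℂ (w + (x + τ * k) • e) (A (w + (x + τ * k) • e))).re
      = a + τ * b + τ ^ 2 * c := by
    intro τ
    have h1 : w + (x + τ * k) • e = (w + x • e) + (τ * k : ℂ) • e := by
      rw [add_smul, add_assoc]
    rw [h1, re_inner_add_smul_map hA]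
    have h2 : ((starRingEnd ℂ) (τ * k) * inner ℂ e (A (w + x • e)))
        = τ * ((starRingEnd ℂ) k * inner ℂ e (A (w + x • e))) := by
      rw [map_mul, Complex.conj_ofReal]; ring
    rw [h2, Complex.re_ofReal_mul, Complex.normSq_mul, Complex.normSq_ofReal]
    simp only [a, b, c]
    ring
  obtain ⟨τ, hτ⟩ : ∃ τ : ℝ, a + τ * b + τ ^ 2 * c = 0 := by
    have hdisc : discrim c b a = Real.sqrt (discrim c b a) * Real.sqrt (discrim c b a) := by
      refine (Real.mul_self_sqrt ?_).symm
      unfold discrim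
      nlinarith [sq_nonneg b]
    obtain ⟨τ, hτ⟩ := exists_quadratic_eq_zero hc.ne' ⟨_, hdisc⟩
    exact ⟨τ, by linear_combination hτ⟩
  refine ⟨x + τ * k, ?_, by rw [hq, hτ]⟩
  have h3 := inner_add_smul_map B w e x
  rw [inner_add_smul_map, he]
  rw [hB, he] at h3
  rw [map_add, map_mul, Complex.conj_ofReal]
  linear_combination -h3 + (τ : ℂ) * hk

/-- If the form of `A` is positive at `e`, then its negative points on the affine lines `w s + ℂ e`,
`0 ≤ s ≤ 1`, are uniformly bounded. -/
lemma exists_norm_le_of_re_inner_neg {A : H →L[ℂ] H} (hA : IsSelfAdjoint A) {e : H} {w : ℝ → H}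
    (heA : 0 < (inner ℂ e (A e)).re) (hw : Continuous w) :
    ∃ R : ℝ, ∀ s ∈ Set.Icc (0 : ℝ) 1, ∀ x : ℂ,
      (inner ℂ (w s + x • e) (A (w s + x • e))).re < 0 → ‖x‖ ≤ R := by
  obtain ⟨C₀, hC₀⟩ := isCompact_Icc.exists_bound_of_continuousOn (s := Set.Icc (0 : ℝ) 1)
    (f := fun s => inner ℂ (w s) (A (w s))) (by fun_prop)
  obtain ⟨C₁, hC₁⟩ := isCompact_Icc.exists_bound_of_continuousOn (s := Set.Icc (0 : ℝ) 1)
    (f := fun s => inner ℂ e (A (w s))) (by fun_prop)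
  -- With `n = ‖x‖` and `q` the value of the form at `e`, the form is at least `q n² - 2 C₁ n - C₀`.
  -- Beyond this radius `n ≥ 1` and `q n > C₀ + 2 C₁`, so the bound is positive.
  refine ⟨1 + (C₀ + 2 * C₁) / (inner ℂ e (A e)).re, fun s hs x hx => ?_⟩
  by_contra! hlarge
  rw [re_inner_add_smul_map hA, Complex.normSq_eq_norm_sq] at hx
  have b0 := (abs_le.mp ((Complex.abs_re_le_norm _).trans (hC₀ s hs))).1
  have b1 : -(‖x‖ * C₁) ≤ ((starRingEnd ℂ) x * inner ℂ e (A (w s))).re := by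
    refine (abs_le.mp ((Complex.abs_re_le_norm _).trans ?_)).1
    rw [norm_mul, RCLike.norm_conj]
    exact mul_le_mul_of_nonneg_left (hC₁ s hs) (norm_nonneg _)
  have hC0 : 0 ≤ C₀ := (norm_nonneg _).trans (hC₀ s hs)
  have hC1 : 0 ≤ C₁ := (norm_nonneg _).trans (hC₁ s hs)
  generalize (inner ℂ e (A e)).re = q at *
  generalize ‖x‖ = n at *
  have h6 : 1 ≤ n := by
    have : 0 ≤ (C₀ + 2 * C₁) / q := by positivity
    linarith
  have h7 : C₀ + 2 * C₁ < q * n := by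
    have : (C₀ + 2 * C₁) / q < n := by linarith
    rwa [div_lt_iff₀' heA] at this
  have h8 := mul_lt_mul_of_pos_left h7 (lt_of_lt_of_le one_pos h6)
  have h9 := mul_le_mul_of_nonneg_right h6 hC0
  linarith

-- Because the form of `B` vanishes at `e₁`, its zeros `w + x • e₁` on an affine line solve a real
-- linear equation in `x`, with determinant `|⟪e₁, B w⟫|² - |⟪w, B e₁⟫|²` up to sign. While `w`
-- moves from `e₂` and the determinant stays positive, the unique solution moves continuously.
-- Without a common zero the form of `A` stays negative there, so the solution stays bounded. When
-- the determinant first vanishes, a limit point exists and `exists_common_zero_of_degenerate`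
-- applies.
set_option maxHeartbeats 800000 in
lemma exists_common_zero_of_sign_change_of_normSq_le {B A : H →L[ℂ] H} (hA : IsSelfAdjoint A)
    {V : Submodule ℂ H} {e₁ e₂ e₃ : H} (h₁ : e₁ ∈ V) (h₂ : e₂ ∈ V) (h₃ : e₃ ∈ V)
    (h₁B : inner ℂ e₁ (B e₁) = 0) (h₂B : inner ℂ e₂ (B e₂) = 0)
    (h₁A : 0 < (inner ℂ e₁ (A e₁)).re) (h₂A : (inner ℂ e₂ (A e₂)).re < 0)
    (hspan : e₃ ∉ Submodule.span ℂ {e₁, e₂})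
    (hle : Complex.normSq (inner ℂ e₂ (B e₁)) ≤ Complex.normSq (inner ℂ e₁ (B e₂))) :
    ∃ v ∈ V, v ≠ 0 ∧ inner ℂ v (B v) = 0 ∧ (inner ℂ v (A v)).re = 0 := by
  by_contra hno
  push Not at hno
  have hind : ∀ a b c : ℂ, a • e₁ + b • e₂ + c • e₃ = 0 → b = 0 ∧ c = 0 := by
    intro a b c h
    have hc : c = 0 := by
      by_contra hc
      refine hspan (Submodule.mem_span_pair.mpr ⟨-(c⁻¹ * a), -(c⁻¹ * b), ?_⟩)
      have := congrArg (fun z => c⁻¹ • z) h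
      simp only [smul_add, smul_smul, smul_zero, inv_mul_cancel₀ hc, one_smul] at this
      rw [eq_comm, ← sub_eq_zero, ← this]
      module
    refine ⟨?_, hc⟩
    -- If `e₂` were a multiple of `e₁`, the form of `A` could not have opposite signs at them.
    by_contra hb
    rw [hc, zero_smul, add_zero] at h
    have h4 : e₂ = (-(b⁻¹ * a)) • e₁ := by
      have := congrArg (fun z => b⁻¹ • z) h
      simp only [smul_add, smul_smul, smul_zero, inv_mul_cancel₀ hb, one_smul] at this
      rw [← sub_eq_zero, ← this]
      module
    rw [h4, map_smul, inner_smul_left, inner_smul_right, ← mul_assoc,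
      ← Complex.normSq_eq_conj_mul_self, Complex.re_ofReal_mul] at h₂A
    nlinarith [Complex.normSq_nonneg (-(b⁻¹ * a))]
  have hlt : Complex.normSq (inner ℂ e₂ (B e₁)) < Complex.normSq (inner ℂ e₁ (B e₂)) := by
    refine lt_of_le_of_ne hle fun heq => ?_
    obtain ⟨y, hy1, hy2⟩ := exists_common_zero_of_degenerate (x := 0) hA h₁B h₁A
      (w := e₂) (by simpa using h₂B) (by simpa using h₂A.le) heq.symm
    refine hno _ (V.add_mem h₂ (V.smul_mem y h₁)) (fun h0 => ?_) hy1 hy2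
    exact one_ne_zero (hind y 1 0 (by rw [← h0]; module)).1
  have hp : inner ℂ e₁ (B e₂) ≠ 0 := by
    intro h
    rw [h, map_zero] at hlt
    exact absurd hlt (not_lt.mpr (Complex.normSq_nonneg _))
  -- This makes `⟪e₁, B w₀⟫` vanish, so the determinant is nonpositive at the end of the path. The
  -- component along `e₃` keeps the path away from multiples of `e₁`.
  set u := -(inner ℂ e₁ (B e₃) / inner ℂ e₁ (B e₂)) with hu
  set w₀ := e₃ + u • e₂ with hw₀
  have hw₀B : inner ℂ e₁ (B w₀) = 0 := by
    rw [hw₀, map_add, map_smul, inner_add_right, inner_smul_right, hu]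
    field_simp
    ring
  let w : ℝ → H := fun s => (1 - s : ℂ) • e₂ + (s : ℂ) • w₀
  have hwc : Continuous w := by fun_prop
  have hwV : ∀ s, w s ∈ V := fun s =>
    V.add_mem (V.smul_mem _ h₂) (V.smul_mem _ (V.add_mem h₃ (V.smul_mem _ h₂)))
  have hwne : ∀ s (x : ℂ), w s + x • e₁ ≠ 0 := by
    intro s x h0
    have h5 := hind x ((1 - s : ℂ) + s * u) s (by rw [← h0]; simp only [w, hw₀]; module)
    rw [h5.2] at h5
    simp at h5
  let f : ℝ → ℝ := fun s =>
    Complex.normSq (inner ℂ e₁ (B (w s))) - Complex.normSq (inner ℂ (w s) (B e₁))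
  have hfc : Continuous f := by
    have := Complex.continuous_normSq
    fun_prop
  have hf0 : 0 < f 0 := by simpa [f, w] using hlt
  have hf1 : f 1 ≤ 0 := by
    simp only [f, w]
    simp [hw₀B, Complex.normSq_nonneg]
  have hS : IsCompact {s ∈ Set.Icc (0 : ℝ) 1 | f s ≤ 0} :=
    isCompact_Icc.inter_right (isClosed_le hfc continuous_const)
  -- `s₀` is the first zero of the determinant.
  obtain ⟨s₀, ⟨⟨hs0, hs1⟩, hfs₀⟩, hmin⟩ := hS.exists_isLeast ⟨1, by simp, hf1⟩
  have hs0' : 0 < s₀ := lt_of_le_of_ne hs0 (by rintro rfl; linarith)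
  have hfpos : ∀ s ∈ Set.Ico 0 s₀, 0 < f s := by
    intro s hs
    by_contra h
    exact absurd (hmin ⟨⟨hs.1, hs.2.le.trans hs1⟩, not_lt.mp h⟩) (not_le.mpr hs.2)
  have hmem : s₀ ∈ closure (Set.Ico 0 s₀) := by
    rw [closure_Ico hs0'.ne]; exact ⟨hs0, le_rfl⟩
  have hfs₀' : f s₀ = 0 := by
    refine le_antisymm hfs₀ ?_
    have : closure (Set.Ico 0 s₀) ⊆ {s | 0 ≤ f s} :=
      closure_minimal (fun s hs => (hfpos s hs).le) (isClosed_le continuous_const hfc)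
    exact this hmem
  -- Cramer's rule for the equation together with its complex conjugate.
  let X : ℝ → ℂ := fun s =>
    (inner ℂ (w s) (B (w s)) * (starRingEnd ℂ) (inner ℂ (w s) (B e₁)) -
      (starRingEnd ℂ) (inner ℂ (w s) (B (w s))) * inner ℂ e₁ (B (w s))) / f s
  have hXc : ContinuousOn X (Set.Ico 0 s₀) := by
    refine ContinuousOn.div ?_ ?_ fun s hs => ?_
    · refine Continuous.continuousOn ?_
      have := Complex.continuous_conj
      fun_prop
    · exact (Complex.continuous_ofReal.comp hfc).continuousOn
    · exact_mod_cast (hfpos s hs).ne'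
  have hXB : ∀ s ∈ Set.Ico 0 s₀, inner ℂ (w s + X s • e₁) (B (w s + X s • e₁)) = 0 := by
    intro s hs
    rw [inner_add_smul_map, h₁B, mul_zero, add_zero]
    have hne : (f s : ℂ) ≠ 0 := by exact_mod_cast (hfpos s hs).ne'
    have hfe : (f s : ℂ) = (starRingEnd ℂ) (inner ℂ e₁ (B (w s))) * inner ℂ e₁ (B (w s)) -
        (starRingEnd ℂ) (inner ℂ (w s) (B e₁)) * inner ℂ (w s) (B e₁) := by
      simp only [f, Complex.ofReal_sub, Complex.normSq_eq_conj_mul_self]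
    simp only [X, map_div₀, map_sub, map_mul, Complex.conj_ofReal, Complex.conj_conj]
    field_simp
    rw [hfe]
    ring
  let G : ℝ → ℂ → ℝ := fun s x => (inner ℂ (w s + x • e₁) (A (w s + x • e₁))).re
  have hGc : Continuous fun z : ℝ × ℂ => G z.1 z.2 := by
    have := Complex.continuous_re
    fun_prop
  have hGneg : ∀ s ∈ Set.Ico 0 s₀, G s (X s) < 0 := by
    intro s hs
    by_contra hge
    have hc : ContinuousOn (fun s => G s (X s)) (Set.Ico 0 s₀) :=
      hGc.comp_continuousOn (continuousOn_id.prodMk hXc)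
    have h00 : (0 : ℝ) ∈ Set.Ico 0 s₀ := ⟨le_rfl, hs0'⟩
    have hG0 : G 0 (X 0) < 0 := by
      have : X 0 = 0 := by simp [X, w, h₂B]
      rw [this]
      simpa [G, w] using h₂A
    obtain ⟨t, ht, ht0⟩ := isPreconnected_Ico.intermediate_value h00 hs hc
      ⟨hG0.le, not_lt.mp hge⟩
    exact hno _ (V.add_mem (hwV t) (V.smul_mem _ h₁)) (hwne t _) (hXB t ht) ht0
  obtain ⟨R, hR⟩ := exists_norm_le_of_re_inner_neg hA h₁A hwc
  -- The projection of this compact set to the parameter is closed and contains `[0, s₀)`, hence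
  -- also `s₀`. No limit of `X` itself is needed.
  have hK : IsCompact ((Set.Icc (0 : ℝ) 1 ×ˢ Metric.closedBall (0 : ℂ) R) ∩
      {z | inner ℂ (w z.1 + z.2 • e₁) (B (w z.1 + z.2 • e₁)) = 0 ∧ G z.1 z.2 ≤ 0}) := by
    refine (isCompact_Icc.prod (isCompact_closedBall _ _)).inter_right ?_
    exact (isClosed_eq (by fun_prop) continuous_const).inter (isClosed_le hGc continuous_const)
  have hsub : Set.Ico 0 s₀ ⊆ Prod.fst '' ((Set.Icc (0 : ℝ) 1 ×ˢ Metric.closedBall (0 : ℂ) R) ∩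
      {z | inner ℂ (w z.1 + z.2 • e₁) (B (w z.1 + z.2 • e₁)) = 0 ∧ G z.1 z.2 ≤ 0}) := by
    intro s hs
    have hs' : s ∈ Set.Icc (0 : ℝ) 1 := ⟨hs.1, hs.2.le.trans hs1⟩
    exact ⟨(s, X s), ⟨⟨hs', by simpa using hR s hs' _ (hGneg s hs)⟩, hXB s hs, (hGneg s hs).le⟩, rfl⟩
  obtain ⟨⟨s, x⟩, ⟨-, hxB, hxG⟩, rfl⟩ :=
    closure_minimal hsub (hK.image continuous_fst).isClosed hmem
  obtain ⟨y, hy1, hy2⟩ := exists_common_zero_of_degenerate hA h₁B h₁A hxB hxG (sub_eq_zero.mp hfs₀')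
  exact hno _ (V.add_mem (hwV _) (V.smul_mem y h₁)) (hwne _ _) hy1 hy2

/-- If the form of the self-adjoint operator `A` takes both signs on the cone of zeros of
`v ↦ ⟪v, B v⟫` in a subspace of dimension at least three, then it has a zero on this cone. -/
lemma exists_common_zero_of_sign_change {B A : H →L[ℂ] H} (hA : IsSelfAdjoint A)
    {V : Submodule ℂ H} {e₁ e₂ e₃ : H} (h₁ : e₁ ∈ V) (h₂ : e₂ ∈ V) (h₃ : e₃ ∈ V)
    (h₁B : inner ℂ e₁ (B e₁) = 0) (h₂B : inner ℂ e₂ (B e₂) = 0)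
    (h₁A : 0 < (inner ℂ e₁ (A e₁)).re) (h₂A : (inner ℂ e₂ (A e₂)).re < 0)
    (hspan : e₃ ∉ Submodule.span ℂ {e₁, e₂}) :
    ∃ v ∈ V, v ≠ 0 ∧ inner ℂ v (B v) = 0 ∧ (inner ℂ v (A v)).re = 0 := by
  rcases le_total (Complex.normSq (inner ℂ e₂ (B e₁))) (Complex.normSq (inner ℂ e₁ (B e₂)))
    with hle | hle
  · exact exists_common_zero_of_sign_change_of_normSq_le hA h₁ h₂ h₃ h₁B h₂B h₁A h₂A hspan hle
  -- Replacing `B` by its adjoint keeps the zeros of the form and reverses the inequality between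
  -- the two off-diagonal entries.
  · have hadj : ∀ x y, inner ℂ x (ContinuousLinearMap.adjoint B y)
        = (starRingEnd ℂ) (inner ℂ y (B x)) := fun x y => by
      rw [ContinuousLinearMap.adjoint_inner_right, inner_conj_symm]
    obtain ⟨v, hv, hv0, hvB, hvA⟩ := exists_common_zero_of_sign_change_of_normSq_le
      (B := ContinuousLinearMap.adjoint B) hA h₁ h₂ h₃ (by rw [hadj, h₁B, map_zero])
      (by rw [hadj, h₂B, map_zero]) h₁A h₂A hspan
      (by rw [hadj, hadj, Complex.normSq_conj, Complex.normSq_conj]; exact hle)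
    refine ⟨v, hv, hv0, ?_, hvA⟩
    rwa [hadj, map_eq_zero] at hvB

end JointNumericalRange

/-! ### Weak separation in finite dimension. -/

/-- A convex set of a Euclidean space that does not contain `0` lies in a closed half space whose
boundary hyperplane does not contain it. -/
lemma exists_inner_nonneg_of_zero_notMem {E : Type*} [NormedAddCommGroup E] [InnerProductSpace ℝ E]
    [FiniteDimensional ℝ E] {W : Set E} (hW : Convex ℝ W) (hne : W.Nonempty) (h0 : 0 ∉ W) :
    ∃ c : E, (∀ w ∈ W, 0 ≤ inner ℝ c w) ∧ ∃ w ∈ W, inner ℝ c w ≠ 0 := by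
  classical
  obtain ⟨w₀, hw₀⟩ := hne
  let L := Submodule.span ℝ W
  have hLc : IsClosed (L : Set E) := L.closed_of_finiteDimensional
  -- `W` need not be closed, so finite subsets are separated strictly and compactness yields a
  -- common functional. Keeping unit functionals inside the span of `W` ensures that the limit is
  -- not zero on all of `W`.
  have hcomp : IsCompact (Metric.sphere (0 : E) 1 ∩ L) := (isCompact_sphere 0 1).inter_right hLc
  have hfin : ∀ F : Finset W, ((Metric.sphere (0 : E) 1 ∩ L) ∩
      ⋂ w ∈ F, {c : E | 0 ≤ inner ℝ c (w : E)}).Nonempty := by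
    intro F
    -- The extra point `w₀` makes `c` nonzero even when `F` is empty.
    let F' : Set E := insert w₀ (Subtype.val '' (F : Set W))
    have hF'fin : F'.Finite := (F.finite_toSet.image _).insert w₀
    have hF'W : F' ⊆ W := by
      rintro x (rfl | ⟨w, -, rfl⟩)
      · exact hw₀
      · exact w.2
    obtain ⟨φ, u, hφ0, hφ⟩ := geometric_hahn_banach_point_closed (convex_convexHull ℝ F')
      (hF'fin.isCompact_convexHull ℝ).isClosed (x := 0)
      (fun h => h0 (convexHull_min hF'W hW h))
    rw [map_zero] at hφ0
    let c' := (InnerProductSpace.toDual ℝ E).symm φ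
    let c : E := L.starProjection c'
    have hc : ∀ w ∈ F', 0 < inner ℝ c w := by
      intro w hw
      have h1 : inner ℝ c w = φ w := by
        rw [← InnerProductSpace.toDual_symm_apply, Submodule.inner_starProjection_left_eq_right,
          Submodule.starProjection_eq_self_iff.mpr (Submodule.subset_span (hF'W hw))]
      rw [h1]
      exact hφ0.trans (hφ w (subset_convexHull ℝ _ hw))
    have hc0 : c ≠ 0 := by
      intro h
      have := hc w₀ (Set.mem_insert _ _)
      rw [h, inner_zero_left] at this
      exact lt_irrefl _ this
    refine ⟨‖c‖⁻¹ • c, ⟨?_, L.smul_mem _ (Submodule.starProjection_apply_mem _ _)⟩, ?_⟩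
    · simp [norm_smul, hc0]
    · simp only [Set.mem_iInter]
      intro w hw
      change 0 ≤ inner ℝ _ _
      rw [real_inner_smul_left]
      exact mul_nonneg (inv_nonneg.mpr (norm_nonneg _))
        (hc w (Set.mem_insert_of_mem _ ⟨w, hw, rfl⟩)).le
  obtain ⟨c, ⟨hc1, hcL⟩, hc⟩ := hcomp.inter_iInter_nonempty
    (fun w : W => {c : E | 0 ≤ inner ℝ c (w : E)})
    (fun w => isClosed_le continuous_const (by fun_prop)) hfin
  simp only [Set.mem_iInter] at hc
  refine ⟨c, fun w hw => hc ⟨w, hw⟩, ?_⟩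
  by_contra! hno
  have : c ∈ Lᗮ := by
    rw [Submodule.mem_orthogonal']
    intro u hu
    induction hu using Submodule.span_induction with
    | mem x hx => exact hno x hx
    | zero => simp
    | add x y _ _ hx hy => rw [inner_add_right, hx, hy, add_zero]
    | smul r x _ hx => rw [real_inner_smul_right, hx, mul_zero]
  have h2 : c = 0 := by
    have := (Submodule.mem_orthogonal' _ _).mp this c hcL
    exact inner_self_eq_zero.mp this
  rw [h2] at hc1
  simp at hc1

/-! ### Convexity of the joint numerical range. -/

section JointNumericalRange

variable {H : Type*} [NormedAddCommGroup H] [InnerProductSpace ℂ H] [CompleteSpace H]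

lemma inner_map_self_eq_re {A : H →L[ℂ] H} (hA : IsSelfAdjoint A) (v : H) :
    inner ℂ v (A v) = ((inner ℂ v (A v)).re : ℂ) := by
  refine (Complex.conj_eq_iff_re.mp ?_).symm
  rw [inner_conj_symm, ← ContinuousLinearMap.adjoint_inner_right, hA.adjoint_eq]

/-- Three forms of self-adjoint operators whose values at two vectors of a subspace of dimension at
least three are opposite have a common zero in it. -/
lemma exists_common_zero_of_opposite {A : Fin 3 → H →L[ℂ] H} (hA : ∀ i, IsSelfAdjoint (A i))
    {V : Submodule ℂ H} (hV : ∀ x ∈ V, ∀ y ∈ V, ¬ V ≤ Submodule.span ℂ {x, y})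
    {e₁ e₂ : H} (h₁ : e₁ ∈ V) (h₂ : e₂ ∈ V) (h₁0 : e₁ ≠ 0) {r : ℝ} (hr : 0 < r)
    (h : ∀ i, (inner ℂ e₂ (A i e₂)).re = -(r * (inner ℂ e₁ (A i e₁)).re)) :
    ∃ v ∈ V, v ≠ 0 ∧ ∀ i, (inner ℂ v (A i v)).re = 0 := by
  by_cases h0 : ∀ i, (inner ℂ e₁ (A i e₁)).re = 0
  · exact ⟨e₁, h₁, h₁0, h0⟩
  push Not at h0
  obtain ⟨i, hi⟩ := h0
  obtain ⟨j, k, hijk⟩ : ∃ j k : Fin 3, ∀ m, m = i ∨ m = j ∨ m = k :=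
    (by decide : ∀ i : Fin 3, ∃ j k : Fin 3, ∀ m, m = i ∨ m = j ∨ m = k) i
  obtain ⟨e₃, h₃, h₃s⟩ := SetLike.not_le_iff_exists.mp (hV e₁ h₁ e₂ h₂)
  set q : Fin 3 → H → ℝ := fun m v => (inner ℂ v (A m v)).re with hq
  have hqA : ∀ m v, inner ℂ v (A m v) = (q m v : ℂ) := fun m v => inner_map_self_eq_re (hA m) v
  set σ := q i e₁
  -- The two real combinations vanish at `e₁`, hence at `e₂`, whose values are proportional. They
  -- form the real and imaginary parts of one complex form. Scaling `A i` by `σ` makes the remaining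
  -- form `σ²` at `e₁` and `-r σ²` at `e₂`.
  let B : H →L[ℂ] H := (A j - (q j e₁ / σ : ℂ) • A i) + Complex.I • (A k - (q k e₁ / σ : ℂ) • A i)
  have hB : ∀ v, inner ℂ v (B v) =
      ((q j v - q j e₁ / σ * q i v : ℝ) : ℂ) +
        ((q k v - q k e₁ / σ * q i v : ℝ) : ℂ) * Complex.I := by
    intro v
    simp only [B, add_apply, sub_apply,
      smul_apply, inner_add_right, inner_sub_right, inner_smul_right, hqA]
    push_cast
    ring
  have hB0 : ∀ v, inner ℂ v (B v) = 0 ↔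
      q j v - q j e₁ / σ * q i v = 0 ∧ q k v - q k e₁ / σ * q i v = 0 := by
    intro v
    rw [hB, Complex.ext_iff]
    simp
  have hσA : ∀ v, (inner ℂ v (((σ : ℂ) • A i) v)).re = σ * q i v := by
    intro v
    rw [smul_apply, inner_smul_right, hqA]
    simp
  have hσ : σ ≠ 0 := hi
  obtain ⟨v, hv, hv0, hvB, hvA⟩ := exists_common_zero_of_sign_change (B := B)
    (A := (σ : ℂ) • A i) (by
      refine IsSelfAdjoint.smul ?_ (hA i)
      rw [isSelfAdjoint_iff]
      exact Complex.conj_ofReal σ) h₁ h₂ h₃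
    ((hB0 _).mpr ⟨by field_simp; ring, by field_simp; ring⟩)
    ((hB0 _).mpr ⟨by simp only [hq, h]; simp only [σ, hq] at hσ ⊢; field_simp; ring,
      by simp only [hq, h]; simp only [σ, hq] at hσ ⊢; field_simp; ring⟩)
    (by rw [hσA]; exact mul_self_pos.mpr hσ)
    (by
      rw [hσA]
      have h5 : q i e₂ = -(r * σ) := h i
      rw [h5]
      have := mul_pos hr (mul_self_pos.mpr hσ)
      linarith)
    h₃s
  rw [hσA] at hvA
  have hvi : q i v = 0 := (mul_eq_zero.mp hvA).resolve_left hσ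
  rw [hB0, hvi, mul_zero, mul_zero, sub_zero, sub_zero] at hvB
  refine ⟨v, hv, hv0, fun m => ?_⟩
  rcases hijk m with rfl | rfl | rfl
  · exact hvi
  · exact hvB.1
  · exact hvB.2

/-- The joint numerical range of three self-adjoint operators on a subspace of dimension at least
three is convex. -/
lemma convex_jointNumericalRange {A : Fin 3 → H →L[ℂ] H} (hA : ∀ i, IsSelfAdjoint (A i))
    {V : Submodule ℂ H} (hV : ∀ x ∈ V, ∀ y ∈ V, ¬ V ≤ Submodule.span ℂ {x, y}) :
    Convex ℝ {p : EuclideanSpace ℝ (Fin 3) |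
      ∃ v ∈ V, ‖v‖ = 1 ∧ ∀ i, p i = (inner ℂ v (A i v)).re} := by
  rw [convex_iff_forall_pos]
  rintro a ⟨e₁, h₁, hn₁, ha⟩ b ⟨e₂, h₂, hn₂, hb⟩ s t hs ht hst
  set c := s • a + t • b with hc
  have hci : ∀ i, c i = s * a i + t * b i := fun i => by simp [hc]
  have hsub : ∀ i v, (inner ℂ v ((A i - (c i : ℂ) • (1 : H →L[ℂ] H)) v)).re =
      (inner ℂ v (A i v)).re - c i * ‖v‖ ^ 2 := by
    intro i v
    rw [sub_apply, smul_apply,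
      one_apply_eq_self, inner_sub_right, inner_smul_right, Complex.sub_re,
      inner_self_eq_norm_sq_to_K, Complex.re_ofReal_mul]
    norm_cast
  -- After subtracting `c`, the values at `e₁` and `e₂` are `t (a - b)` and `-s (a - b)`, so the
  -- ratio is `s / t`.
  obtain ⟨v, hv, hv0, hvA⟩ := exists_common_zero_of_opposite
    (A := fun i => A i - (c i : ℂ) • (1 : H →L[ℂ] H))
    (fun i => (hA i).sub (IsSelfAdjoint.smul (by
      rw [isSelfAdjoint_iff]; exact Complex.conj_ofReal _) (IsSelfAdjoint.one _)))
    hV h₁ h₂ (by rintro rfl; simp at hn₁) (div_pos hs ht) (fun i => by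
      rw [hsub, hsub, hn₁, hn₂, ← ha, ← hb, hci]
      field_simp
      have : s = 1 - t := by linarith
      rw [this]; ring)
  have hvn : ‖v‖ ≠ 0 := norm_ne_zero_iff.mpr hv0
  refine ⟨(‖v‖⁻¹ : ℂ) • v, V.smul_mem _ hv, by simp [norm_smul, hvn], fun i => ?_⟩
  have h3 := hvA i
  rw [hsub] at h3
  rw [map_smul, inner_smul_left, inner_smul_right, ← mul_assoc, map_inv₀, Complex.conj_ofReal,
    ← Complex.ofReal_inv, ← Complex.ofReal_mul, Complex.re_ofReal_mul, sub_eq_zero.mp h3]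
  field_simp

/-- If no real combination of three self-adjoint operators is positive and nonzero as a form on a
subspace of dimension at least three, then their forms have a common zero in it. -/
lemma exists_unit_common_zero {A : Fin 3 → H →L[ℂ] H} (hA : ∀ i, IsSelfAdjoint (A i))
    {V : Submodule ℂ H} (hV : ∀ x ∈ V, ∀ y ∈ V, ¬ V ≤ Submodule.span ℂ {x, y})
    (hpos : ∀ c : Fin 3 → ℝ, (∀ v ∈ V, ‖v‖ = 1 → 0 ≤ ∑ i, c i * (inner ℂ v (A i v)).re) →
      ∀ v ∈ V, ‖v‖ = 1 → ∑ i, c i * (inner ℂ v (A i v)).re = 0) :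
    ∃ v ∈ V, ‖v‖ = 1 ∧ ∀ i, inner ℂ v (A i v) = 0 := by
  set W := {p : EuclideanSpace ℝ (Fin 3) | ∃ v ∈ V, ‖v‖ = 1 ∧ ∀ i, p i = (inner ℂ v (A i v)).re}
    with hW
  have hmem : ∀ v ∈ V, ‖v‖ = 1 → WithLp.toLp 2 (fun i => (inner ℂ v (A i v)).re) ∈ W :=
    fun v hv hn => ⟨v, hv, hn, fun i => rfl⟩
  by_cases h0 : (0 : EuclideanSpace ℝ (Fin 3)) ∈ W
  · obtain ⟨v, hv, hn, h⟩ := h0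
    refine ⟨v, hv, hn, fun i => ?_⟩
    rw [inner_map_self_eq_re (hA i), ← h i]
    simp
  exfalso
  have hne : W.Nonempty := by
    obtain ⟨e, he, hes⟩ := SetLike.not_le_iff_exists.mp (hV 0 V.zero_mem 0 V.zero_mem)
    have he0 : ‖e‖ ≠ 0 := norm_ne_zero_iff.mpr (by rintro rfl; exact hes (Submodule.zero_mem _))
    exact ⟨_, hmem ((‖e‖⁻¹ : ℂ) • e) (V.smul_mem _ he) (by simp [norm_smul, he0])⟩
  obtain ⟨c, hc, w, ⟨v, hv, hn, hw⟩, hcw⟩ :=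
    exists_inner_nonneg_of_zero_notMem (convex_jointNumericalRange hA hV) hne h0
  have hin : ∀ w : EuclideanSpace ℝ (Fin 3), inner ℝ c w = ∑ i, c i * w i := fun w => by
    rw [PiLp.inner_apply]
    exact Finset.sum_congr rfl fun i _ => by simp [mul_comm]
  rw [hin] at hcw
  simp only [hw] at hcw
  refine hcw (hpos c (fun v hv hn => ?_) v hv hn)
  have := hc _ (hmem v hv hn)
  rwa [hin] at this

end JointNumericalRange

/-! ### A basis with almost vanishing diagonal. -/

section TraceZero

variable {H : Type*} [NormedAddCommGroup H] [InnerProductSpace ℂ H] [CompleteSpace H]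

lemma orthonormal_insert_of_orthogonal {S : Set H} (hS : Orthonormal ℂ (Subtype.val : S → H))
    {x : H} (hx : ‖x‖ = 1) (hxS : x ∈ (Submodule.span ℂ S)ᗮ) :
    Orthonormal ℂ (Subtype.val : ↥(insert x S) → H) := by
  have h1 : ∀ v ∈ S, inner ℂ v x = 0 := fun v hv =>
    (Submodule.mem_orthogonal _ _).mp hxS v (Submodule.subset_span hv)
  refine ⟨?_, ?_⟩
  · rintro ⟨v, rfl | hv⟩
    · exact hx
    · exact hS.1 ⟨v, hv⟩
  · rintro ⟨v, hv⟩ ⟨u, hu⟩ hvu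
    have hne : v ≠ u := fun h => hvu (Subtype.ext h)
    change inner ℂ v u = 0
    rcases hv with rfl | hv <;> rcases hu with rfl | hu
    · exact absurd rfl hne
    · rw [← inner_conj_symm, h1 u hu, map_zero]
    · exact h1 v hv
    · exact hS.2 (i := ⟨v, hv⟩) (j := ⟨u, hu⟩) (fun h => hne (congrArg Subtype.val h))

/-- Three linearly independent self-adjoint operators of trace zero vanish on the diagonal for a
suitable orthonormal basis, up to at most two vectors of the basis. -/
lemma exists_hilbertBasis_diagonal_zero {K : Submodule ℝ (H →L[ℂ] H)}
    (hK : Module.finrank ℝ K = 3) (hsa : ∀ A ∈ K, IsSelfAdjoint A)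
    (htr : ∀ A ∈ K, ∀ (w : Set H) (g : HilbertBasis w ℂ H),
      HasSum (fun k => inner ℂ (g k) (A (g k))) 0) :
    ∃ (w : Set H) (g : HilbertBasis w ℂ H) (T : Finset w), T.card ≤ 2 ∧
      ∀ k ∉ T, ∀ A ∈ K, inner ℂ (g k) (A (g k)) = 0 := by
  classical
  obtain ⟨S, -, hS⟩ := zorn_subset_nonempty
    {S : Set H | Orthonormal ℂ (Subtype.val : S → H) ∧ ∀ v ∈ S, ∀ A ∈ K, inner ℂ v (A v) = 0}
    (fun c hc cc _ => ⟨⋃₀ c,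
      ⟨orthonormal_sUnion_of_directed cc.directedOn fun x hx => (hc hx).1,
        fun v ⟨s, hs, hv⟩ => (hc hs).2 v hv⟩, fun _ => Set.subset_sUnion_of_mem⟩)
    ∅ ⟨orthonormal_empty ℂ H, by simp⟩
  obtain ⟨⟨hSo, hSK⟩, hSmax⟩ := hS
  set V := (Submodule.span ℂ S)ᗮ with hV
  have hdim : ∃ x ∈ V, ∃ y ∈ V, V ≤ Submodule.span ℂ {x, y} := by
    by_contra! hno
    have : Module.Finite ℝ K := Module.finite_of_finrank_pos (by omega)
    let b := Module.finBasisOfFinrankEq ℝ K hK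
    obtain ⟨v, hv, hn, hvA⟩ := exists_unit_common_zero (A := fun i => (b i : H →L[ℂ] H))
      (fun i => hsa _ (b i).2) hno (fun c hc x hx hxn => by
        obtain ⟨w, g, hw, hg⟩ :=
          (orthonormal_insert_of_orthogonal hSo hxn hx).exists_hilbertBasis_extension
        set A : H →L[ℂ] H := ∑ i, c i • (b i : H →L[ℂ] H) with hA
        have hAK : A ∈ K := K.sum_mem fun i _ => K.smul_mem _ (b i).2
        have hAre : ∀ v, (inner ℂ v (A v)).re =
            ∑ i, c i * (inner ℂ v ((b i : H →L[ℂ] H) v)).re := by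
          intro v
          rw [hA, sum_apply, inner_sum, Complex.re_sum]
          refine Finset.sum_congr rfl fun i _ => ?_
          rw [smul_apply, ← Complex.coe_smul, inner_smul_right, Complex.re_ofReal_mul]
        -- In a basis extending `S` and `x`, the terms from `S` are zero and the others are
        -- nonnegative. As they sum to zero, the term of `x` is zero.
        have hsum := Complex.hasSum_re (htr A hAK w g)
        rw [Complex.zero_re, hasSum_zero_iff_of_nonneg] at hsum
        · have := congrFun hsum ⟨x, hw (Set.mem_insert _ _)⟩
          simp only [hg] at this
          rw [← hAre]
          exact this
        · intro k
          rw [hg]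
          by_cases hk : (k : H) ∈ S
          · simp [hSK _ hk A hAK]
          · change 0 ≤ (inner ℂ (k : H) (A k)).re
            rw [hAre]
            refine hc _ ?_ (by simpa [hg] using g.orthonormal.1 k)
            rw [hV, Submodule.mem_orthogonal]
            intro u hu
            induction hu using Submodule.span_induction with
            | mem u hu =>
              have h2 := g.orthonormal.2 (i := ⟨u, hw (Set.mem_insert_of_mem _ hu)⟩) (j := k)
                (by rintro rfl; exact hk hu)
              simpa [hg] using h2
            | zero => simp
            | add x y _ _ hx hy => rw [inner_add_left, hx, hy, add_zero]
            | smul r x _ hx => rw [inner_smul_left, hx, mul_zero])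
    -- Maximality puts `v` into `S`, although it is a unit vector orthogonal to `S`.
    have hvS : v ∈ S := by
      refine hSmax (y := insert v S) ⟨orthonormal_insert_of_orthogonal hSo hn hv, ?_⟩
        (Set.subset_insert _ _) (Set.mem_insert _ _)
      rintro u (rfl | hu) A hA
      · have hrep := congrArg Subtype.val (b.sum_repr ⟨A, hA⟩)
        simp only [AddSubmonoidClass.coe_finsetSum, SetLike.val_smul] at hrep
        rw [← hrep, sum_apply, inner_sum]
        refine Finset.sum_eq_zero fun i _ => ?_
        rw [smul_apply, ← Complex.coe_smul, inner_smul_right, hvA, mul_zero]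
      · exact hSK u hu A hA
    have h3 := (Submodule.mem_orthogonal _ _).mp hv v (Submodule.subset_span hvS)
    rw [inner_self_eq_zero] at h3
    simp [h3] at hn
  obtain ⟨x, -, y, -, hxy⟩ := hdim
  obtain ⟨w, g, hw, hg⟩ := hSo.exists_hilbertBasis_extension
  -- The basis vectors outside `S` are independent and lie in `V`, which is spanned by two vectors.
  have hli : LinearIndependent ℂ (fun k : {k : w // (k : H) ∉ S} => (k.1 : H)) := by
    have := g.orthonormal.linearIndependent.comp (Subtype.val : {k : w // (k : H) ∉ S} → w)
      Subtype.val_injective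
    rw [hg] at this
    exact this
  have hcard := linearIndependent_le_span' _ hli (({x, y} : Finset H) : Set H) (by
    rintro _ ⟨⟨k, hk⟩, rfl⟩
    have hkV : (k : H) ∈ V := by
      rw [hV, Submodule.mem_orthogonal]
      intro u hu
      induction hu using Submodule.span_induction with
      | mem u hu =>
        have h2 := g.orthonormal.2 (i := ⟨u, hw hu⟩) (j := k)
          (by rintro rfl; exact hk hu)
        simpa [hg] using h2
      | zero => simp
      | add x y _ _ hx hy => rw [inner_add_left, hx, hy, add_zero]
      | smul r x _ hx => rw [inner_smul_left, hx, mul_zero]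
    simpa using hxy hkV)
  have hfin : Finite {k : w // (k : H) ∉ S} :=
    Cardinal.lt_aleph0_iff_finite.mp (hcard.trans_lt (Cardinal.natCast_lt_aleph0))
  have hfin' : {k : w | (k : H) ∉ S}.Finite := hfin
  refine ⟨w, g, hfin'.toFinset, ?_, ?_⟩
  · rw [← Set.ncard_eq_toFinset_card _ hfin']
    change Nat.card {k : w // (k : H) ∉ S} ≤ 2
    have h4 := Cardinal.toNat_le_toNat hcard (Cardinal.natCast_lt_aleph0)
    rw [Cardinal.toNat_natCast] at h4
    exact h4.trans ((Fintype.card_coe _).trans_le Finset.card_le_two)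
  · intro k hk A hA
    have : (k : H) ∈ S := by simpa using hk
    rw [hg]
    exact hSK _ this A hA

end TraceZero

/-! ### Conditional states and the associated space. -/

section

variable {HA HB : Type*} [NormedAddCommGroup HA] [InnerProductSpace ℂ HA] [CompleteSpace HA]
  [NormedAddCommGroup HB] [InnerProductSpace ℂ HB] {ι : Type*}

lemma inner_tmul_right (φ : HTensor HA HB) (a : HA) (b : HB) :
    inner ℂ φ (tmul a b) = inner ℂ (slice b φ) a := by
  refine tensor_induction (P := fun φ => inner ℂ φ (tmul a b) = inner ℂ (slice b φ) a)
    (isClosed_eq (by fun_prop) (by fun_prop)) (by simp) (fun a' b' => ?_) (fun x y hx hy => ?_) φ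
  · rw [slice_tmul, inner_smul_left, inner_conj_symm, tmul, tmul, UniformSpace.Completion.inner_coe,
      TensorProduct.inner_tmul, mul_comm]
  · rw [inner_add_left, map_add, inner_add_left, hx, hy]

lemma hasSum_inner_slice {κ : Type*} (g : HilbertBasis κ ℂ HB) (φ ψ : HTensor HA HB) :
    HasSum (fun k => inner ℂ (slice (g k) φ) (slice (g k) ψ)) (inner ℂ φ ψ) := by
  simpa [inner_tmul_right] using (hasSum_tmul_slice g ψ).mapL (innerSL ℂ φ)

lemma hasSum_norm_sq_slice {κ : Type*} (g : HilbertBasis κ ℂ HB) (ψ : HTensor HA HB) :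
    HasSum (fun k => ‖slice (g k) ψ‖ ^ 2) (‖ψ‖ ^ 2) := by
  have h := Complex.hasSum_re (hasSum_inner_slice g ψ ψ)
  simp only [inner_self_eq_norm_sq_to_K] at h
  norm_cast at h

variable [CompleteSpace HB]

lemma exists_conjWrt_hilbertBasis (f : HilbertBasis ι ℂ HB) {κ : Type*}
    (g : HilbertBasis κ ℂ HB) :
    ∃ g' : HilbertBasis κ ℂ HB, ∀ k, g' k = conjWrt f (g k) := by
  classical
  have ho : Orthonormal ℂ (fun k => conjWrt f (g k)) := by
    have hg := orthonormal_iff_ite.mp g.orthonormal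
    rw [orthonormal_iff_ite]
    intro s t
    rw [inner_conjWrt, hg]
    simp [eq_comm]
  refine ⟨HilbertBasis.mkOfOrthogonalEqBot ho ?_, fun k => ?_⟩
  rotate_left
  · rw [HilbertBasis.coe_mkOfOrthogonalEqBot]
  rw [Submodule.eq_bot_iff]
  intro x hx
  have h1 : ∀ k, inner ℂ (g k) (conjWrt f x) = 0 := by
    intro k
    have h2 : inner ℂ (conjWrt f (g k)) x = 0 :=
      (Submodule.mem_orthogonal _ _).mp hx _ (Submodule.subset_span ⟨k, rfl⟩)
    rw [← inner_conjWrt f, conjWrt_conjWrt, ← inner_conj_symm, h2, map_zero]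
  have h3 : conjWrt f x = 0 := by
    have h4 : g.repr (conjWrt f x) = 0 := by
      ext k
      rw [g.repr_apply_apply, h1]
      rfl
    exact (LinearIsometryEquiv.map_eq_zero_iff _).mp h4
  rw [← norm_eq_zero, ← norm_conjWrt f, h3, norm_zero]

lemma isSelfAdjoint_of_mem_associatedSpace (f : HilbertBasis ι ℂ HB) {M : ℕ}
    (ψ : Fin M → HTensor HA HB) {A : HB →L[ℂ] HB} (hA : A ∈ associatedSpace f ψ) :
    IsSelfAdjoint A := by
  unfold associatedSpace at hA
  induction hA using Submodule.span_induction with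
  | mem A hA =>
    obtain ⟨m, l, -, rfl | rfl⟩ := hA
    · rw [ContinuousLinearMap.isSelfAdjoint_iff', map_add, ContinuousLinearMap.adjoint_comp,
        ContinuousLinearMap.adjoint_comp, ContinuousLinearMap.adjoint_adjoint,
        ContinuousLinearMap.adjoint_adjoint, add_comm]
    · rw [ContinuousLinearMap.isSelfAdjoint_iff', map_smulₛₗ, map_sub,
        ContinuousLinearMap.adjoint_comp,
        ContinuousLinearMap.adjoint_comp, ContinuousLinearMap.adjoint_adjoint,
        ContinuousLinearMap.adjoint_adjoint, Complex.conj_I, neg_smul, ← smul_neg, neg_sub]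
  | zero => exact IsSelfAdjoint.zero _
  | add A B _ _ hA hB => exact hA.add hB
  | smul r A _ hA => exact IsSelfAdjoint.smul (IsSelfAdjoint.all r) hA

/-- Diagonal entries become inner products of Alice's conditional states. `toOperator` is linear in
`v` but `slice` is conjugate linear, whence the conjugation. -/
lemma inner_adjoint_toOperator (f : HilbertBasis ι ℂ HB) (φ ψ : HTensor HA HB) (v : HB) :
    inner ℂ v ((ContinuousLinearMap.adjoint (toOperator f φ) ∘L toOperator f ψ) v) =
      inner ℂ (slice (conjWrt f v) φ) (slice (conjWrt f v) ψ) := by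
  rw [ContinuousLinearMap.comp_apply, ContinuousLinearMap.adjoint_inner_right, toOperator_apply,
    toOperator_apply]

/-- The diagonal entries of `X m† X l` sum to `⟪ψ m, ψ l⟫` by Parseval in the conjugate basis, and
this is zero for `m ≠ l`. -/
lemma hasSum_inner_associatedSpace (f : HilbertBasis ι ℂ HB) {M : ℕ}
    {ψ : Fin M → HTensor HA HB} (hψ : Orthonormal ℂ ψ) {A : HB →L[ℂ] HB}
    (hA : A ∈ associatedSpace f ψ) {κ : Type*} (g : HilbertBasis κ ℂ HB) :
    HasSum (fun k => inner ℂ (g k) (A (g k))) 0 := by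
  obtain ⟨g', hg'⟩ := exists_conjWrt_hilbertBasis f g
  have hX : ∀ m l, m ≠ l → HasSum (fun k => inner ℂ (g k) ((ContinuousLinearMap.adjoint
      (toOperator f (ψ m)) ∘L toOperator f (ψ l)) (g k))) 0 := by
    intro m l hml
    simp only [inner_adjoint_toOperator, ← hg']
    rw [← hψ.2 hml]
    exact hasSum_inner_slice g' _ _
  unfold associatedSpace at hA
  induction hA using Submodule.span_induction with
  | mem A hA =>
    obtain ⟨m, l, hml, rfl | rfl⟩ := hA
    · simpa only [add_apply, inner_add_right, add_zero] using (hX m l hml).add (hX l m hml.symm)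
    · simpa only [smul_apply, sub_apply, inner_smul_right, inner_sub_right, sub_zero, mul_zero]
        using ((hX m l hml).sub (hX l m hml.symm)).mul_left Complex.I
  | zero => simp
  | add A B _ _ hA hB => simpa only [add_apply, inner_add_right, add_zero] using hA.add hB
  | smul r A _ hA =>
    simpa only [smul_apply, ← Complex.coe_smul, inner_smul_right, mul_zero]
      using hA.mul_left (r : ℂ)

/-- A vector on whose diagonal all operators of the associated space vanish gives orthogonal
conditional states. -/
lemma inner_slice_conjWrt_eq_zero (f : HilbertBasis ι ℂ HB) {M : ℕ} (ψ : Fin M → HTensor HA HB)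
    {v : HB} (hv : ∀ A ∈ associatedSpace f ψ, inner ℂ v (A v) = 0) {m l : Fin M} (hml : m ≠ l) :
    inner ℂ (slice (conjWrt f v) (ψ m)) (slice (conjWrt f v) (ψ l)) = 0 := by
  have h1 := hv _ (Submodule.subset_span ⟨m, l, hml, Or.inl rfl⟩)
  have h2 := hv _ (Submodule.subset_span ⟨m, l, hml, Or.inr rfl⟩)
  rw [add_apply, inner_add_right, inner_adjoint_toOperator, inner_adjoint_toOperator] at h1
  rw [smul_apply, sub_apply, inner_smul_right, inner_sub_right, inner_adjoint_toOperator,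
    inner_adjoint_toOperator] at h2
  have h3 := (mul_eq_zero.mp h2).resolve_left Complex.I_ne_zero
  linear_combination (h1 + h3) / 2

end

/-! ### Probability carried by two vectors of Bob. -/

section Schmidt

variable {HA HB : Type*} [NormedAddCommGroup HA] [InnerProductSpace ℂ HA] [CompleteSpace HA]
  [NormedAddCommGroup HB] [InnerProductSpace ℂ HB]

/-- Parseval's identity for the coefficients of an orthonormal expansion. -/
lemma hasSum_norm_sq_of_hasSum_smul {H κ : Type*} [NormedAddCommGroup H] [InnerProductSpace ℂ H]
    {a : κ → H} (ha : Orthonormal ℂ a) {c : κ → ℂ} {x : H} (h : HasSum (fun k => c k • a k) x) :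
    HasSum (fun k => ‖c k‖ ^ 2) (‖x‖ ^ 2) := by
  classical
  have hc : ∀ k, inner ℂ (a k) x = c k := by
    intro k
    have h1 := h.mapL (innerSL ℂ (a k))
    simp only [innerSL_apply_apply, inner_smul_right, orthonormal_iff_ite.mp ha] at h1
    refine h1.unique ?_
    have h2 := hasSum_single (f := fun j => c j * if k = j then 1 else 0) k
      fun j hj => by simp [hj.symm]
    simpa using h2
  have h2 := h.mapL (innerSL ℂ x)
  simp only [innerSL_apply_apply, inner_smul_right] at h2
  have h3 : ∀ k, c k * inner ℂ x (a k) = ((‖c k‖ ^ 2 : ℝ) : ℂ) := by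
    intro k
    rw [← inner_conj_symm, hc, Complex.mul_conj']
    push_cast
    rfl
  simp only [h3, inner_self_eq_norm_sq_to_K] at h2
  have h4 := Complex.hasSum_re h2
  norm_cast at h4

/-- The weight of a vector on at most two orthonormal vectors of `HB` is at most the sum of the two
largest Schmidt coefficients. -/
lemma sum_norm_sq_slice_le {ψ : HTensor HA HB} {p : ℕ → ℝ} (hp : IsSchmidtSequence ψ p)
    {κ : Type*} {g : κ → HB} (hg : Orthonormal ℂ g) (T : Finset κ) (hT : T.card ≤ 2) :
    ∑ k ∈ T, ‖slice (g k) ψ‖ ^ 2 ≤ p 0 + p 1 := by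
  classical
  obtain ⟨hanti, hnn, a, b, ha, hb, hsum⟩ := hp
  have hslice : ∀ v, HasSum (fun k : {k // p k ≠ 0} => p k * ‖inner ℂ v (b k)‖ ^ 2)
      (‖slice v ψ‖ ^ 2) := by
    intro v
    have h1 := hsum.mapL (slice v)
    simp only [map_smul, slice_tmul, smul_smul] at h1
    have h2 := hasSum_norm_sq_of_hasSum_smul ha h1
    simpa only [norm_mul, mul_pow, Complex.norm_real, Real.norm_eq_abs, sq_abs,
      Real.sq_sqrt (hnn _)] using h2
  have h01 : p 1 ≤ p 0 := hanti zero_le_one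
  refine hasSum_le_of_sum_le (hasSum_sum fun v (_ : v ∈ T) => hslice (g v)) fun F => ?_
  simp only [← Finset.mul_sum]
  -- Bessel's inequality for `g` bounds each weight by 1, and for `b` it bounds their sum by 2. The
  -- weighted sum of the decreasing `p` is then largest with weight 1 on each of the first two
  -- terms.
  set C : {k // p k ≠ 0} → ℝ := fun k => ∑ v ∈ T, ‖inner ℂ (g v) (b k)‖ ^ 2
  have hC0 : ∀ k, 0 ≤ C k := fun k => Finset.sum_nonneg fun _ _ => by positivity
  have hC1 : ∀ k, C k ≤ 1 := fun k => by
    have := hg.sum_inner_products_le (b k) (s := T)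
    rwa [hb.1, one_pow] at this
  have hC2 : ∑ k ∈ F, C k ≤ 2 := by
    rw [Finset.sum_comm]
    calc ∑ v ∈ T, ∑ k ∈ F, ‖inner ℂ (g v) (b k)‖ ^ 2 ≤ ∑ v ∈ T, (1 : ℝ) := by
          refine Finset.sum_le_sum fun v _ => ?_
          have := hb.sum_inner_products_le (g v) (s := F)
          rw [hg.1, one_pow] at this
          simpa only [norm_inner_symm (g v)] using this
      _ ≤ 2 := by simpa using hT
  -- Every coefficient is compared with `p 1`; only index 0 exceeds it, by `p 0 - p 1` times a
  -- weight at most 1.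
  have hterm : ∀ k : {k // p k ≠ 0}, p k * C k ≤ p 1 * C k + if k.1 = 0 then p 0 - p 1 else 0 := by
    intro k
    split_ifs with hk
    · rw [hk]
      nlinarith [hC1 k]
    · rw [add_zero]
      exact mul_le_mul_of_nonneg_right (hanti (Nat.one_le_iff_ne_zero.mpr hk)) (hC0 k)
  have hcount : ∑ k ∈ F, (if k.1 = 0 then p 0 - p 1 else 0) ≤ p 0 - p 1 := by
    rw [← Finset.sum_filter, Finset.sum_const, nsmul_eq_mul]
    have h1 : (F.filter (fun k => k.1 = 0)).card ≤ 1 := by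
      rw [Finset.card_le_one]
      intro x hx y hy
      exact Subtype.ext ((Finset.mem_filter.mp hx).2.trans (Finset.mem_filter.mp hy).2.symm)
    have h2 : ((F.filter (fun k => k.1 = 0)).card : ℝ) ≤ 1 := by exact_mod_cast h1
    nlinarith
  calc ∑ k ∈ F, p k * C k ≤ ∑ k ∈ F, (p 1 * C k + if k.1 = 0 then p 0 - p 1 else 0) :=
        Finset.sum_le_sum fun k _ => hterm k
    _ = p 1 * ∑ k ∈ F, C k + ∑ k ∈ F, (if k.1 = 0 then p 0 - p 1 else 0) := by
        rw [Finset.sum_add_distrib, Finset.mul_sum]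
    _ ≤ p 1 * 2 + (p 0 - p 1) := by
        gcongr
        exact hnn 1
    _ = p 0 + p 1 := by ring

end Schmidt

/-! ### Measurements in orthonormal bases. -/

section Protocol

/-- Orthonormal vectors are at distance `√2`, so the balls of radius `1/2` are disjoint.
Countability lets a basis index the outcomes of a measurement, which are numbered by `ℕ`. -/
lemma countable_of_orthonormal {H κ : Type*} [NormedAddCommGroup H] [InnerProductSpace ℂ H]
    [TopologicalSpace.SeparableSpace H] {v : κ → H} (hv : Orthonormal ℂ v) : Countable κ := by
  refine Pairwise.countable_of_isOpen_disjoint (s := fun k => Metric.ball (v k) (1 / 2)) ?_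
    (fun _ => Metric.isOpen_ball) (fun k => ⟨v k, Metric.mem_ball_self (by norm_num)⟩)
  intro i j hij
  refine Metric.ball_disjoint_ball ?_
  have h1 : ‖v i - v j‖ ^ 2 = 2 := by
    rw [@norm_sub_sq ℂ, hv.2 hij, hv.1, hv.1]
    norm_num
  rw [dist_eq_norm]
  nlinarith [norm_nonneg (v i - v j)]

variable {H : Type*} [NormedAddCommGroup H] [InnerProductSpace ℂ H]

/-- The operator `|v⟩⟨v|`. -/
noncomputable def rankOneOp (v : H) : H →L[ℂ] H := (innerSL ℂ v).smulRight v

@[simp] lemma rankOneOp_apply (v x : H) : rankOneOp v x = inner ℂ v x • v := rfl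

/-- Completeness of the measurement is the basis expansion of `x`; numbers outside the range of `e`
carry the zero operator and never occur as outcomes. -/
lemma isMeasurement_extend_rankOneOp [CompleteSpace H] {κ : Type*} (g : HilbertBasis κ ℂ H)
    {e : κ → ℕ} (he : Function.Injective e) :
    IsMeasurement (Function.extend e (fun k => rankOneOp (g k)) 0) := by
  intro x
  rw [← he.hasSum_iff]
  · convert g.hasSum_repr x using 2 with k
    rw [Function.comp_apply, he.extend_apply, g.repr_apply_apply]
    refine ext_inner_left ℂ fun y => ?_
    rw [ContinuousLinearMap.adjoint_inner_right, rankOneOp_apply, rankOneOp_apply,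
      inner_smul_left, inner_smul_right, inner_smul_right, inner_conj_symm,
      inner_self_eq_norm_sq_to_K, g.orthonormal.1]
    simp [mul_comm]
  · intro n hn
    rw [Function.extend_apply' _ _ _ (fun ⟨k, hk⟩ => hn ⟨k, hk⟩)]
    simp

variable {HA HB : Type*} [NormedAddCommGroup HA] [InnerProductSpace ℂ HA] [CompleteSpace HA]
  [NormedAddCommGroup HB] [InnerProductSpace ℂ HB]

lemma tensorOp_tmul (S : HA →L[ℂ] HA) (T : HB →L[ℂ] HB) (a : HA) (b : HB) :
    tensorOp S T (tmul a b) = tmul (S a) (T b) := by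
  simp [tensorOp, tmul]

lemma tensorOp_zero_left (T : HB →L[ℂ] HB) (φ : HTensor HA HB) : tensorOp 0 T φ = 0 := by
  refine tensor_induction (P := fun φ => tensorOp 0 T φ = 0)
    (isClosed_eq (by fun_prop) (by fun_prop)) (by simp) (fun a b => ?_) (fun x y hx hy => ?_) φ
  · rw [tensorOp_tmul]; simp [tmul]
  · rw [map_add, hx, hy, add_zero]

lemma tensorOp_zero_right (S : HA →L[ℂ] HA) (φ : HTensor HA HB) : tensorOp S 0 φ = 0 := by
  refine tensor_induction (P := fun φ => tensorOp S 0 φ = 0)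
    (isClosed_eq (by fun_prop) (by fun_prop)) (by simp) (fun a b => ?_) (fun x y hx hy => ?_) φ
  · rw [tensorOp_tmul]; simp [tmul]
  · rw [map_add, hx, hy, add_zero]

/-- After Bob's outcome `v` the state is a product, so only Alice's factor still carries
information. -/
lemma tensorOp_one_rankOneOp (v : HB) (φ : HTensor HA HB) :
    tensorOp 1 (rankOneOp v) φ = tmul (slice v φ) v := by
  simp only [← tmulL_apply]
  refine tensor_induction
    (P := fun φ => tensorOp 1 (rankOneOp v) φ = tmulL v (slice v φ))
    (isClosed_eq (by fun_prop) (by fun_prop)) (by simp only [map_zero]) (fun a b => ?_)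
    (fun x y hx hy => ?_) φ
  · rw [tensorOp_tmul, slice_tmul, map_smul, tmulL_apply, rankOneOp_apply, tmul_smul]
    rfl
  · simp only [map_add, hx, hy]

variable [CompleteSpace HB]

/-- Alice measures in an orthonormal basis. -/
lemma exists_alice_basis_protocol {Ω : Type} {n : ℕ} {κ : Type*} [Countable κ]
    (g : HilbertBasis κ ℂ HA) (next : κ → LOCC HA HB Ω n) (o₀ : Ω) :
    ∃ P : LOCC HA HB Ω (n + 1), ∀ o φ,
      P.prob o φ = ∑' k, (next k).prob o (tensorOp (rankOneOp (g k)) 1 φ) := by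
  obtain ⟨e, he⟩ := exists_injective_nat κ
  refine ⟨.alice _ (isMeasurement_extend_rankOneOp g he)
    (Function.extend e next fun _ => .announce o₀), fun o φ => ?_⟩
  rw [LOCC.prob, ← he.tsum_eq]
  · simp only [he.extend_apply]
  · intro i hi
    by_contra hr
    refine hi ?_
    have hr' : ¬ ∃ k, e k = i := fun ⟨k, hk⟩ => hr ⟨k, hk⟩
    dsimp only
    rw [Function.extend_apply' _ _ _ hr', Function.extend_apply' _ _ _ hr', Pi.zero_apply,
      tensorOp_zero_left, LOCC.prob]
    simp

/-- Bob measures in an orthonormal basis. -/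
lemma exists_bob_basis_protocol {Ω : Type} {n : ℕ} {κ : Type*} [Countable κ]
    (g : HilbertBasis κ ℂ HB) (next : κ → LOCC HA HB Ω n) (o₀ : Ω) :
    ∃ P : LOCC HA HB Ω (n + 1), ∀ o φ,
      P.prob o φ = ∑' k, (next k).prob o (tmul (slice (g k) φ) (g k)) := by
  obtain ⟨e, he⟩ := exists_injective_nat κ
  refine ⟨.bob _ (isMeasurement_extend_rankOneOp g he)
    (Function.extend e next fun _ => .announce o₀), fun o φ => ?_⟩
  rw [LOCC.prob, ← he.tsum_eq]
  · simp only [he.extend_apply, tensorOp_one_rankOneOp]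
  · intro i hi
    by_contra hr
    refine hi ?_
    have hr' : ¬ ∃ k, e k = i := fun ⟨k, hk⟩ => hr ⟨k, hk⟩
    dsimp only
    rw [Function.extend_apply' _ _ _ hr', Function.extend_apply' _ _ _ hr', Pi.zero_apply,
      tensorOp_zero_right, LOCC.prob]
    simp

/-- Alice can distinguish orthogonal states of her system. -/
lemma exists_alice_protocol_of_orthogonal [TopologicalSpace.SeparableSpace HA] {M : ℕ}
    (s : Fin M → HA) (hs : ∀ l m, l ≠ m → inner ℂ (s l) (s m) = 0) {v : HB} (hv : ‖v‖ = 1) :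
    ∃ P : LOCC HA HB (Option (Fin M)) 1, ∀ l m,
      P.prob (some m) (tmul (s l) v) = if m = l then ENNReal.ofReal (‖s l‖ ^ 2) else 0 := by
  classical
  let u : Fin M → HA := fun l => (‖s l‖⁻¹ : ℂ) • s l
  have hu1 : ∀ l, s l ≠ 0 → ‖u l‖ = 1 := fun l hl => by
    simp [u, norm_smul, norm_ne_zero_iff.mpr hl]
  have hu2 : ∀ l m, l ≠ m → inner ℂ (u l) (u m) = 0 := fun l m hlm => by
    simp [u, hs l m hlm]
  have hu3 : ∀ l m, s l ≠ 0 → u l = u m → l = m := fun l m hl h => by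
    by_contra hlm
    have h1 := hu2 l m hlm
    rw [← h, inner_self_eq_zero] at h1
    simpa [h1] using hu1 l hl
  -- Some conditional states may vanish. They cannot be normalized and are left out; they contribute
  -- probability zero anyway.
  have ho : Orthonormal ℂ (Subtype.val : {x : HA | ∃ l, s l ≠ 0 ∧ x = u l} → HA) := by
    constructor
    · rintro ⟨_, l, hl, rfl⟩
      exact hu1 l hl
    · rintro ⟨_, l, hl, rfl⟩ ⟨_, m, hm, rfl⟩ h
      exact hu2 l m fun hlm => h (by subst hlm; rfl)
  obtain ⟨w, g, hw, hg⟩ := ho.exists_hilbertBasis_extension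
  have : Countable w := countable_of_orthonormal g.orthonormal
  let label : w → Option (Fin M) := fun k =>
    if h : ∃ l, s l ≠ 0 ∧ (k : HA) = u l then some h.choose else none
  obtain ⟨P, hP⟩ := exists_alice_basis_protocol (HB := HB) g
    (fun k => .announce (n := 0) (label k)) none
  refine ⟨P, fun l m => ?_⟩
  simp only [hP, LOCC.prob, tensorOp_tmul, rankOneOp_apply, one_apply_eq_self, norm_tmul, hv,
    mul_one, norm_smul, g.orthonormal.1]
  by_cases hl : s l = 0
  · simp [hl]
  let k₀ : w := ⟨u l, hw ⟨l, hl, rfl⟩⟩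
  have hsl : s l = (‖s l‖ : ℂ) • u l := by
    have : (‖s l‖ : ℂ) ≠ 0 := by exact_mod_cast norm_ne_zero_iff.mpr hl
    simp only [u, smul_smul, mul_inv_cancel₀ this, one_smul]
  have hlabel : label k₀ = some l := by
    have h : ∃ l', s l' ≠ 0 ∧ (k₀ : HA) = u l' := ⟨l, hl, rfl⟩
    simp only [label, dif_pos h]
    -- The chosen index is `l` itself because distinct indices give distinct normalized vectors.
    exact congrArg some (hu3 l _ hl h.choose_spec.2).symm
  rw [tsum_eq_single k₀]
  · have h1 : ‖(inner ℂ (g k₀) (s l) : ℂ)‖ = ‖s l‖ := by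
      rw [hg]
      change ‖(inner ℂ (u l) (s l) : ℂ)‖ = ‖s l‖
      conv_lhs => rw [hsl, inner_smul_right, inner_self_eq_norm_sq_to_K, hu1 l hl]
      simp
    rw [h1, hlabel]
    simp only [Option.some.injEq, eq_comm (a := l)]
  · intro k hk
    have h1 : inner ℂ (g k) (g k₀) = 0 := g.orthonormal.2 hk
    have h2 : g k₀ = u l := by rw [hg]
    rw [h2] at h1
    rw [hsl, inner_smul_right, h1]
    simp

end Protocol

end LocalDiscrimination

/-! ### The protocol and its success probability. -/

theorem theorem2p2 {HA HB : Type*}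
    [NormedAddCommGroup HA] [InnerProductSpace ℂ HA] [CompleteSpace HA]
    [TopologicalSpace.SeparableSpace HA]
    [NormedAddCommGroup HB] [InnerProductSpace ℂ HB] [CompleteSpace HB]
    [TopologicalSpace.SeparableSpace HB]
    {ι : Type*} (f : HilbertBasis ι ℂ HB)
    {M : ℕ} (ψ : Fin M → LocalDiscrimination.HTensor HA HB) (hψ : Orthonormal ℂ ψ)
    (hK : Module.finrank ℝ (LocalDiscrimination.associatedSpace f ψ) = 3) :
    ∃ (n : ℕ) (P : LocalDiscrimination.LOCC HA HB (Option (Fin M)) n),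
      P.IsConclusive ψ ∧
        ENNReal.ofReal (1 - ⨆ l : Fin M,
          (LocalDiscrimination.schmidtCoeff (ψ l) 0 + LocalDiscrimination.schmidtCoeff (ψ l) 1)) ≤
          P.successProb ψ := by
  classical
  obtain ⟨w, g, T, hT, hg⟩ := LocalDiscrimination.exists_hilbertBasis_diagonal_zero hK
    (fun A hA => LocalDiscrimination.isSelfAdjoint_of_mem_associatedSpace f ψ hA)
    (fun A hA w g => LocalDiscrimination.hasSum_inner_associatedSpace f hψ hA g)
  -- Bob measures in the conjugate basis, since `toOperator f ψ v` is the slice of `ψ` along the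
  -- conjugate of `v`.
  obtain ⟨g', hg'⟩ := LocalDiscrimination.exists_conjWrt_hilbertBasis f g
  have : Countable w := LocalDiscrimination.countable_of_orthonormal g.orthonormal
  have hex : ∀ k : w, ∃ P : LocalDiscrimination.LOCC HA HB (Option (Fin M)) 1, ∀ l m,
      P.prob (some m) (LocalDiscrimination.tmul (LocalDiscrimination.slice (g' k) (ψ l)) (g' k)) =
        if m = l then
          ENNReal.ofReal (if k ∈ T then 0 else ‖LocalDiscrimination.slice (g' k) (ψ l)‖ ^ 2)
        else 0 := by
    intro k
    by_cases hk : k ∈ T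
    -- On the at most two exceptional outcomes orthogonality may fail, so nothing is concluded.
    · exact ⟨.announce none, fun l m => by simp [LocalDiscrimination.LOCC.prob, hk]⟩
    · simp only [if_neg hk]
      refine LocalDiscrimination.exists_alice_protocol_of_orthogonal
        (fun l => LocalDiscrimination.slice (g' k) (ψ l)) (fun l m hlm => ?_) (g'.orthonormal.1 k)
      rw [hg']
      exact LocalDiscrimination.inner_slice_conjWrt_eq_zero f ψ (hg k hk) hlm
  choose next hnext using hex
  obtain ⟨P, hP⟩ := LocalDiscrimination.exists_bob_basis_protocol g' next none
  refine ⟨2, P, fun l m hml => ?_, ?_⟩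
  · simp [hP, hnext, hml]
  refine le_iInf fun l => ?_
  -- The success probability is the total probability 1 minus the weight of `ψ l` on `T`.
  have hsum := (LocalDiscrimination.hasSum_norm_sq_slice g' (ψ l)).sub
    (hasSum_sum_of_ne_finset_zero (s := T)
      (f := fun k => if k ∈ T then ‖LocalDiscrimination.slice (g' k) (ψ l)‖ ^ 2 else 0)
      fun k hk => if_neg hk)
  have hT' : ∑ k ∈ T, (if k ∈ T then ‖LocalDiscrimination.slice (g' k) (ψ l)‖ ^ 2 else 0) ≤
      LocalDiscrimination.schmidtCoeff (ψ l) 0 + LocalDiscrimination.schmidtCoeff (ψ l) 1 := by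
    rw [Finset.sum_congr rfl fun k hk => if_pos hk]
    exact LocalDiscrimination.sum_norm_sq_slice_le
      (LocalDiscrimination.isSchmidtSequence_schmidtCoeff (ψ l)) g'.orthonormal T hT
  have hsup := le_ciSup (Set.finite_range fun l : Fin M =>
    LocalDiscrimination.schmidtCoeff (ψ l) 0 + LocalDiscrimination.schmidtCoeff (ψ l) 1).bddAbove l
  have hterm : ∀ k, ‖LocalDiscrimination.slice (g' k) (ψ l)‖ ^ 2 -
      (if k ∈ T then ‖LocalDiscrimination.slice (g' k) (ψ l)‖ ^ 2 else 0) =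
      if k ∈ T then 0 else ‖LocalDiscrimination.slice (g' k) (ψ l)‖ ^ 2 := by
    intro k
    split_ifs <;> simp
  simp only [hterm, hψ.1, one_pow] at hsum
  simp only [hP, hnext, if_true]
  rw [← ENNReal.ofReal_tsum_of_nonneg (fun k => by split_ifs <;> positivity) hsum.summable,
    hsum.tsum_eq]
  exact ENNReal.ofReal_le_ofReal (by linarith)
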